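/- **Setting.** Let $\mathcal D\subset\mathbb R^2$ be nonempty, convex and compact, and let $N\ge 1$. Let $\phi_1,\dots,\phi_S$ ($S\ge1$) be random functions on $\mathcal D$ given by the multi-fidelity Gaussian process model $\phi_1=\delta_1$, $\phi_f=\rho_{f-1}\phi_{f-1}+\delta_f$ for $2\le f\le S$, where $\rho_f>0$ and $\delta_1,\dots,\delta_S$ are independent Gaussian processes on $\mathcal D$ with continuous sample paths, mean functions $\mu^f$ and covariance functions $k^f$ ($\mu^f$, $k^f$ continuous). The sensory function is $\phi=\phi_S$. A measurement of fidelity $f$ at $x$ is $y=\phi_f(x)+\epsilon$, with $\epsilon\sim\mathcal N(0,\sigma_f^2)$, $\sigma_f>0$. For $f\le f'$ write $\rho_{f:f'}=\prod_{i=f}^{f'-1}\rho_i$ (so $\rho_{f:f}=1$), $m_f(x)=\sum_{i\le f}\rho_{i:f}\mu^i(x)$ and $k_{f,f'}(x,x')=\sum_{i\le\min(f,f')}\rho_{i:f}\rho_{i:f'}k^i(x,x')$. For measurements $y_a$ of fidelity $f_a$ at $x_a$ ($a=1,\dots,n$), the posterior mean and variance of $\phi$ are $$m_S(x)+\mathbf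 k(x)^\top(\mathbf K+\Theta)^{-1}\boldsymbol\nu,\qquad k_{S,S}(x,x)-\mathbf k(x)^\top(\mathbf K+\Theta)^{-1}\mathbf k(x),$$ where $\mathbf K_{ab}=k_{f_a,f_b}(x_a,x_b)$, $\Theta=\operatorname{diag}(\sigma_{f_a}^2)$, $\mathbf k(x)_a=k_{f_a,S}(x_a,x)$ and $\nu_a=y_a-m_{f_a}(x_a)$. **Algorithm (SMLC).** Before deployment, finitely many measurements are taken at fixed points and fidelities. Let $M^{(0)}$ be the maximum over $\mathcal D$ of the posterior variance given these. Fix generators $g^{(0)}_1,\dots,g_N^{(0)}\in\mathbb R^2$. In iteration $t=0,1,2,\dots$ let $\hat\phi^{(t)}$ and $\mathrm{var}^{(t)}$ be the posterior mean and variance of $\phi$ given all measurements collected so far, and let $v_i^{(t)}=\{q\in\mathcal D:\|q-g_i^{(t)}\|\le\|q-g_j^{(t)}\|\ \forall j\}$ be the Voronoi cells. The next generator $g_i^{(t+1)}$ is the estimated centroid $\int_{v_i^{(t)}}q\,\hat\phi^{(t)}(q)\,dq\,\big/\int_{v_i^{(t)}}\hat\phi^{(t)}(q)\,dq$ (if the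 denominator is $0$, then $g_i^{(t+1)}=g_i^{(t)}$). Each agent $i$ whose cell is nonempty chooses to learn with probability $F\big(M_{v_i}^{(t)}/M^{(0)}\big)$, where $M_{v_i}^{(t)}=\max_{x\in v_i^{(t)}}\mathrm{var}^{(t)}(x)$ (with $0/0=0$). In that case it takes a measurement of fidelity $S$ at a point of $v_i^{(t)}$ that maximizes $\mathrm{var}^{(t)}$ over $v_i^{(t)}$ (ties are broken by a measurable rule that depends only on the measurements, sampling points and decisions made before). Otherwise it drives to its estimated centroid; an agent whose cell is empty does not measure. The processes $\delta_f$, all measurement noises and the uniform random numbers behind the Bernoulli decisions are mutually independent. **Claim.** Let $F:[0,1]\to[0,1]$ be continuous and strictly increasing. Then $\hat\phi^{(t)}$ converges in probability to $\phi$, uniformly on $\mathcal D$: for every $\varepsilon>0$, $$\lim_{t\to\infty}P\Big(\sup_{x\in\mathcal D}\big|\hat\phi^{(t)}(x)-\phi(x)\big|\ge\varepsilon\Big)=0 .$$ -/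

import Mathlib

open MeasureTheory ProbabilityTheory Filter Topology
open scoped Matrix

noncomputable section

/-- The Euclidean plane. -/
abbrev Plane : Type := EuclideanSpace ℝ (Fin 2)

/-- Area on the subtype `D`. -/
def area (D : Set Plane) : Measure D := (volume : Measure Plane).comap Subtype.val

/-- Parameters of a multi-fidelity Gaussian process on `D` with fidelity levels `0, …, s`
(`Fin.last s` is the ground truth): mean and covariance functions of the refinements `δ_f`,
scaling factors `ρ_f` between consecutive levels, and noise standard deviations `σ_f`.
(Symmetry and positive semidefiniteness of `cov f` need not be listed: they hold as soon as
`cov f` is the covariance function of a process.) -/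
structure MFModel (D : Set Plane) (s : ℕ) where
  mean : Fin (s + 1) → D → ℝ
  cov : Fin (s + 1) → D → D → ℝ
  ρ : Fin s → ℝ
  σ : Fin (s + 1) → ℝ
  mean_cont : ∀ f, Continuous (mean f)
  cov_cont : ∀ f, Continuous (Function.uncurry (cov f))
  ρ_pos : ∀ f, 0 < ρ f
  σ_pos : ∀ f, 0 < σ f

namespace MFModel

variable {D : Set Plane} {s : ℕ} (M : MFModel D s)

/-- `ρ_{f:f'} = ∏_{i=f}^{f'-1} ρ_i`, which is `1` for `f = f'`. -/
def ρProd (f f' : Fin (s + 1)) : ℝ :=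
  ∏ i : Fin s with f ≤ i.castSucc ∧ i.castSucc < f', M.ρ i

/-- Prior mean of the level-`f` function: `∑_{i ≤ f} ρ_{i:f} μ^i(x)`. -/
def priorMean (f : Fin (s + 1)) (x : D) : ℝ :=
  ∑ i : Fin (s + 1) with i ≤ f, M.ρProd i f * M.mean i x

/-- Prior covariance between level `f` at `x` and level `f'` at `x'`:
`∑_{i ≤ min(f,f')} ρ_{i:f} ρ_{i:f'} k^i(x,x')`. -/
def priorCov (f f' : Fin (s + 1)) (x x' : D) : ℝ :=
  ∑ i : Fin (s + 1) with i ≤ min f f', M.ρProd i f * M.ρProd i f' * M.cov i x x'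

section Posterior

/- A data set: measurement `a : ι` was taken at fidelity `lev a`, at the point `loc a`, and
returned the value `y a`. -/
variable {ι : Type} [Fintype ι] [DecidableEq ι] (lev : ι → Fin (s + 1)) (loc : ι → D)

/-- `K + Θ`: covariance matrix of the measurements. -/
def gram : Matrix ι ι ℝ :=
  Matrix.of (fun a a' => M.priorCov (lev a) (lev a') (loc a) (loc a'))
    + Matrix.diagonal (fun a => M.σ (lev a) ^ 2)

/-- The vector `k(x)` of prior covariances between the measurements and the ground truth at `x`. -/
def crossCov (x : D) : ι → ℝ :=
  fun a => M.priorCov (lev a) (Fin.last s) (loc a) x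

/-- Posterior mean of the ground truth at `x`: `μ(x) + k(x)ᵀ (K + Θ)⁻¹ ν`. -/
def postMean (y : ι → ℝ) (x : D) : ℝ :=
  M.priorMean (Fin.last s) x +
    M.crossCov lev loc x ⬝ᵥ
      ((M.gram lev loc)⁻¹ *ᵥ (fun a => y a - M.priorMean (lev a) (loc a)))

/-- Posterior covariance of the ground truth: `k(x,x') - k(x)ᵀ (K + Θ)⁻¹ k(x')`. -/
def postCov (x x' : D) : ℝ :=
  M.priorCov (Fin.last s) (Fin.last s) x x' -
    M.crossCov lev loc x ⬝ᵥ ((M.gram lev loc)⁻¹ *ᵥ M.crossCov lev loc x')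

end Posterior

end MFModel

/-- All the quantities that occur in one run of the SMLC algorithm with `N` agents and `n₀`
measurements collected before deployment, as functions on a sample space `Ω`.
The iterations are numbered `0, 1, 2, …`. -/
structure SMLCRun (D : Set Plane) (s N n₀ : ℕ) (Ω : Type*) where
  /-- fidelity levels of the measurements collected before deployment -/
  lev₀ : Fin n₀ → Fin (s + 1)
  /-- locations of the measurements collected before deployment -/
  loc₀ : Fin n₀ → D
  /-- initial configuration of the agents -/
  η₀ : Fin N → Plane
  /-- refinement processes -/
  δ : Fin (s + 1) → D → Ω → ℝ
  /-- sensory function at each fidelity level -/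
  φ : Fin (s + 1) → D → Ω → ℝ
  /-- noise of the measurements collected before deployment -/
  noise₀ : Fin n₀ → Ω → ℝ
  /-- noise of the sample (if any) of agent `i` in iteration `t` -/
  noise : ℕ → Fin N → Ω → ℝ
  /-- uniform random number from which agent `i` draws its Bernoulli variable in iteration `t` -/
  coin : ℕ → Fin N → Ω → ℝ
  /-- `b t i = true`: agent `i` executes a learning step in iteration `t`; otherwise it executes
  a coverage step -/
  b : ℕ → Fin N → Ω → Bool
  /-- point of maximum posterior variance in the cell of agent `i` in iteration `t` -/
  xmax : ℕ → Fin N → Ω → D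
  /-- `gen t i`: the point generating the cell of agent `i` in iteration `t`; `gen (t + 1) i` is the
  estimated centroid of that cell computed in iteration `t` -/
  gen : ℕ → Fin N → Ω → Plane
  /-- position of agent `i` at the beginning of iteration `t` -/
  pos : ℕ → Fin N → Ω → Plane

namespace SMLCRun

variable {D : Set Plane} {s N n₀ : ℕ} {Ω : Type*} (R : SMLCRun D s N n₀ Ω) (M : MFModel D s)

/-- Values measured before deployment: `y = φ_f(x) + ε`. -/
def y₀ (j : Fin n₀) (ω : Ω) : ℝ := R.φ (R.lev₀ j) (R.loc₀ j) ω + R.noise₀ j ω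

/-- Value that agent `i` measures at `xmax t i` if it executes a learning step in iteration `t`. -/
def y (t : ℕ) (i : Fin N) (ω : Ω) : ℝ := R.φ (Fin.last s) (R.xmax t i ω) ω + R.noise t i ω

/-- Labels of the measurements available in iteration `t`: those collected before deployment, and
those of the pairs (iteration `< t`, agent) in which a learning step was executed. -/
abbrev Obs (t : ℕ) (ω : Ω) : Type :=
  Fin n₀ ⊕ {p : Fin t × Fin N // R.b p.1 p.2 ω = true}

def obsLev (t : ℕ) (ω : Ω) : R.Obs t ω → Fin (s + 1) :=
  Sum.elim R.lev₀ (fun _ => Fin.last s)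

def obsLoc (t : ℕ) (ω : Ω) : R.Obs t ω → D :=
  Sum.elim R.loc₀ (fun p => R.xmax p.1.1 p.1.2 ω)

def obsVal (t : ℕ) (ω : Ω) : R.Obs t ω → ℝ :=
  Sum.elim (fun j => R.y₀ j ω) (fun p => R.y p.1.1 p.1.2 ω)

/-- The estimate `φ̂` in iteration `t`: posterior mean given the measurements available then. -/
def est (t : ℕ) (ω : Ω) (x : D) : ℝ :=
  M.postMean (R.obsLev t ω) (R.obsLoc t ω) (R.obsVal t ω) x

/-- Posterior variance in iteration `t`. -/
def var (t : ℕ) (ω : Ω) (x : D) : ℝ :=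
  M.postCov (R.obsLev t ω) (R.obsLoc t ω) x x

/-- Voronoi cell of agent `i` in iteration `t`; points equidistant from several nearest generators
belong to each of their cells, so that the cells are compact and cover `D`. -/
def cell (t : ℕ) (i : Fin N) (ω : Ω) : Set D :=
  {q | ∀ j, ‖(q : Plane) - R.gen t i ω‖ ≤ ‖(q : Plane) - R.gen t j ω‖}

/-- Maximum posterior variance over the cell of agent `i` in iteration `t`. -/
def maxVarCell (t : ℕ) (i : Fin N) (ω : Ω) : ℝ := sSup (R.var M t ω '' R.cell t i ω)

/-- Maximum posterior variance over `D` in iteration `t`. -/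
def maxVar (t : ℕ) (ω : Ω) : ℝ := sSup (Set.range (R.var M t ω))

/-- Estimated mass of the cell of agent `i` in iteration `t`. -/
def mass (t : ℕ) (i : Fin N) (ω : Ω) : ℝ := ∫ q in R.cell t i ω, R.est M t ω q ∂(area D)

/-- Estimated centroid of the cell of agent `i` in iteration `t`; where it is undefined because the
estimated mass vanishes, the old generator is kept. -/
def centroid (t : ℕ) (i : Fin N) (ω : Ω) : Plane :=
  open Classical in
  if R.mass M t i ω = 0 then R.gen t i ω
  else (R.mass M t i ω)⁻¹ • ∫ q in R.cell t i ω, R.est M t ω q • (q : Plane) ∂(area D)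

/-- What is known when the sampling points of iteration `t` are selected: the measurements
collected before deployment, and all earlier decisions, sampling points and samples. -/
@[reducible] def history (t : ℕ) : MeasurableSpace Ω :=
  (⨆ j, MeasurableSpace.comap (R.y₀ j) inferInstance) ⊔
    ⨆ p : Fin t × Fin N,
      MeasurableSpace.comap
        (fun ω => (R.b p.1 p.2 ω, R.xmax p.1 p.2 ω,
          if R.b p.1 p.2 ω = true then R.y p.1 p.2 ω else 0)) inferInstance

end SMLCRun

/-- The sources of randomness of a run. -/
inductive SMLCSource (s N n₀ : ℕ) : Type
  | field (f : Fin (s + 1))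
  | noise₀ (j : Fin n₀)
  | noise (t : ℕ) (i : Fin N)
  | coin (t : ℕ) (i : Fin N)

namespace SMLCRun

variable {D : Set Plane} {s N n₀ : ℕ} {Ω : Type*}

/-- The σ-algebra generated by a source of randomness (for a process: by all its values). -/
@[reducible] def sourceSigma (R : SMLCRun D s N n₀ Ω) : SMLCSource s N n₀ → MeasurableSpace Ω
  | .field f => MeasurableSpace.comap (fun ω x => R.δ f x ω) MeasurableSpace.pi
  | .noise₀ j => MeasurableSpace.comap (R.noise₀ j) inferInstance
  | .noise t i => MeasurableSpace.comap (R.noise t i) inferInstance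
  | .coin t i => MeasurableSpace.comap (R.coin t i) inferInstance

/-- The random inputs of the run follow the multi-fidelity Gaussian process model `M`. -/
structure IsMFGP [MeasurableSpace Ω] (R : SMLCRun D s N n₀ Ω) (M : MFModel D s)
    (P : Measure Ω) : Prop where
  -- the refinements are Gaussian processes with mean `μ^f`, covariance `k^f`, continuous paths
  field_meas : ∀ f x, Measurable (R.δ f x)
  field_gauss : ∀ f, IsGaussianProcess (R.δ f) P
  field_mean : ∀ f x, ∫ ω, R.δ f x ω ∂P = M.mean f x
  field_cov : ∀ f x x', covariance (R.δ f x) (R.δ f x') P = M.cov f x x'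
  field_cont : ∀ f ω, Continuous (fun x => R.δ f x ω)
  -- the autoregressive structure `φ_f = ρ_{f-1} φ_{f-1} + δ_f`
  level_zero : ∀ x ω, R.φ 0 x ω = R.δ 0 x ω
  level_succ : ∀ (f : Fin s) x ω,
    R.φ f.succ x ω = M.ρ f * R.φ f.castSucc x ω + R.δ f.succ x ω
  -- measurement noise, and the uniform variables behind the Bernoulli draws
  noise₀_meas : ∀ j, Measurable (R.noise₀ j)
  noise₀_law : ∀ j, P.map (R.noise₀ j) = gaussianReal 0 (Real.toNNReal (M.σ (R.lev₀ j) ^ 2))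
  noise_meas : ∀ t i, Measurable (R.noise t i)
  noise_law : ∀ t i, P.map (R.noise t i) = gaussianReal 0 (Real.toNNReal (M.σ (Fin.last s) ^ 2))
  coin_meas : ∀ t i, Measurable (R.coin t i)
  coin_law : ∀ t i, P.map (R.coin t i) = (volume : Measure ℝ).restrict (Set.Icc 0 1)
  -- everything is mutually independent
  indep : iIndep R.sourceSigma P

/-- The run executes the SMLC algorithm with learning probabilities given by `F`. -/
structure IsSMLC (R : SMLCRun D s N n₀ Ω) (M : MFModel D s) (F : ℝ → ℝ) : Prop where
  gen_zero : ∀ i ω, R.gen 0 i ω = R.η₀ i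
  gen_succ : ∀ t i ω, R.gen (t + 1) i ω = R.centroid M t i ω
  -- the sampling point maximizes the posterior variance over the cell, and its choice among
  -- several maximizers depends on nothing but the history
  xmax_mem : ∀ t i ω, (R.cell t i ω).Nonempty → R.xmax t i ω ∈ R.cell t i ω
  xmax_max : ∀ t i ω, IsMaxOn (R.var M t ω) (R.cell t i ω) (R.xmax t i ω)
  xmax_meas : ∀ t i, Measurable[R.history t] (R.xmax t i)
  -- learning with probability `F (M_{v_i} / M⁰)`; an agent with an empty cell does not sample
  learn : ∀ t i ω, R.b t i ω = true ↔
    (R.cell t i ω).Nonempty ∧ R.coin t i ω < F (R.maxVarCell M t i ω / R.maxVar M 0 ω)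
  -- a learning agent moves to its sampling point, any other agent to its estimated centroid
  pos_zero : ∀ i ω, R.pos 0 i ω = R.η₀ i
  pos_succ : ∀ t i ω, R.pos (t + 1) i ω =
    if R.b t i ω = true then (R.xmax t i ω : Plane) else R.centroid M t i ω

end SMLCRun

end

/-!
The proof separates what the data say about the field from how the data were chosen.

*Bayes' rule under adaptive sampling.* The sampling points depend on earlier data, hence on the
field, so that the measurements are not jointly Gaussian. Divide `P` by the likelihood
`likFull M t (ω, ω)` of the data given the field. Under the resulting measure every measurement is
pure noise, whatever point is chosen, and therefore the field is independent of all data and keeps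
its law (`Decoupled.measure`, `SMLCRun.IsMFGP.decoupled`); here agents that do not measure are made
to report pure noise. Undoing the change of measure gives
`∫ G(ω, ω) dP = ∫ posteriorExp G dP`, where `posteriorExp` freezes the data and weights the law of
the field by the likelihood of these frozen data (`SMLCRun.IsMFGP.lintegral_posteriorExp`). With
frozen points the tilted law is Gaussian, with the mean and variance of the kriging formulas
(`SMLCRun.IsMFGP.posterior`). It follows that the estimate and its variance are the mean and the
variance of a true posterior.

*The posterior variance tends to zero in probability.* The posterior variance is the least mean
square error among linear estimates. If many measurements of top fidelity were taken near a point,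
their average is such an estimate with a small error (`SMLCRun.IsMFGP.postCov_le_of_near`). By
compactness there is thus a number `K` such that points where the variance exceeds `c` are sampled
in at most `K` iterations (`SMLCRun.IsMFGP.exists_card_learning_le`). But while the variance exceeds
`c` somewhere, an agent whose cell contains such a point learns once all coins of the iteration
are below `F (c / M⁰) > 0`; this has a probability `q > 0` and is independent of the past. Hence the
probabilities that the variance exceeds `c` in iteration `t` have a sum of at most `K / q`
(`SMLCRun.IsMFGP.tendsto_measure_lt_var`).

*From pointwise to uniform convergence.* At a single point, Bayes' rule and Chebyshev's inequality
bound the probability of a large error by the posterior variance. To pass from a finite net to all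
of `D`, the estimate has to be equicontinuous in probability. If the estimate varies by more than
`η` between two points at distance less than `r`, then given the data the sensory function does so
with probability at least `1/2`, since a Gaussian variable is at least as large as its mean in
absolute value with that probability (`SMLCRun.IsMFGP.half_le_posteriorExp_oscSet`). By Markov's
inequality this is at most twice as likely as an oscillation of the sensory function itself, whose
probability tends to zero with `r` because the paths are continuous on a compact set.
-/

open scoped ENNReal NNReal

noncomputable section

/-! ### Shifting Gaussian noise -/

/-- Density at `y` of `𝒩(s, σ²)` with respect to `𝒩(0, σ²)`: the likelihood of the signal `s` when
`y` is measured, normalized so that it is `1` for `s = 0`. -/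
def likRatio (σ y s : ℝ) : ℝ≥0∞ := ENNReal.ofReal (Real.exp ((2 * y * s - s ^ 2) / (2 * σ ^ 2)))

lemma likRatio_ne_zero (σ y s : ℝ) : likRatio σ y s ≠ 0 := by
  simp [likRatio, Real.exp_pos]

lemma likRatio_ne_top (σ y s : ℝ) : likRatio σ y s ≠ ∞ := ENNReal.ofReal_ne_top

@[simp] lemma likRatio_zero (σ y : ℝ) : likRatio σ y 0 = 1 := by simp [likRatio]

lemma measurable_likRatio (σ : ℝ) : Measurable (fun p : ℝ × ℝ => likRatio σ p.1 p.2) := by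
  unfold likRatio; fun_prop

lemma lintegral_shift_gaussianReal {σ : ℝ} (hσ : 0 < σ) (s : ℝ) {h : ℝ → ℝ≥0∞}
    (hh : Measurable h) :
    ∫⁻ e, h (s + e) * (likRatio σ (s + e) s)⁻¹ ∂(gaussianReal 0 (Real.toNNReal (σ ^ 2))) =
      ∫⁻ e, h e ∂(gaussianReal 0 (Real.toNNReal (σ ^ 2))) := by
  have hv : Real.toNNReal (σ ^ 2) ≠ 0 := by
    simpa using hσ.ne'
  have hm : Measurable fun e => (likRatio σ (s + e) s)⁻¹ := by unfold likRatio; fun_prop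
  rw [gaussianReal_of_var_ne_zero _ hv,
    lintegral_withDensity_eq_lintegral_mul _ (measurable_gaussianPDF _ _) (by fun_prop),
    lintegral_withDensity_eq_lintegral_mul _ (measurable_gaussianPDF _ _) (by fun_prop),
    ← lintegral_add_left_eq_self
      (gaussianPDF 0 (Real.toNNReal (σ ^ 2)) * fun e => h e) s]
  refine lintegral_congr fun e => ?_
  simp only [Pi.mul_apply]
  have key : gaussianPDF 0 (Real.toNNReal (σ ^ 2)) e =
      gaussianPDF 0 (Real.toNNReal (σ ^ 2)) (s + e) * likRatio σ (s + e) s := by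
    simp only [gaussianPDF, likRatio]
    rw [← ENNReal.ofReal_mul (gaussianPDFReal_nonneg _ _ _)]
    congr 1
    simp only [gaussianPDFReal, Real.coe_toNNReal _ (sq_nonneg σ), sub_zero]
    rw [mul_assoc (_)⁻¹, ← Real.exp_add]
    congr 2
    field_simp
    ring
  rw [key, mul_comm (h _), ← mul_assoc, mul_assoc (gaussianPDF _ _ _),
    ENNReal.mul_inv_cancel (likRatio_ne_zero _ _ _) (likRatio_ne_top _ _ _), mul_one]

lemma lintegral_pi_prod {κ : Type*} [Fintype κ] (μ : κ → Measure ℝ)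
    [∀ i, IsProbabilityMeasure (μ i)] {f : κ → ℝ → ℝ≥0∞} (hf : ∀ i, Measurable (f i)) :
    ∫⁻ e, ∏ i, f i (e i) ∂(Measure.pi μ) = ∏ i, ∫⁻ x, f i x ∂(μ i) := by
  have hind : iIndepFun (fun i (e : κ → ℝ) => f i (e i)) (Measure.pi μ) :=
    iIndepFun_pi (X := fun i => f i) (fun i => (hf i).aemeasurable)
  rw [lintegral_prod_eq_prod_lintegral_of_indepFun Finset.univ _ hind
    (fun i => (hf i).comp (measurable_pi_apply i))]
  refine Finset.prod_congr rfl fun i _ => ?_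
  exact (measurePreserving_eval μ i).lintegral_comp (hf i)

/-- Law of a vector of independent centred Gaussian errors with standard deviations `σ i`. -/
def noiseLaw {κ : Type*} [Fintype κ] (σ : κ → ℝ) : Measure (κ → ℝ) :=
  Measure.pi fun i => gaussianReal 0 (Real.toNNReal (σ i ^ 2))

instance {κ : Type*} [Fintype κ] (σ : κ → ℝ) : IsProbabilityMeasure (noiseLaw σ) := by
  unfold noiseLaw; infer_instance

lemma lintegral_shift_noiseLaw {κ : Type*} [Fintype κ] {σ : κ → ℝ} (hσ : ∀ i, 0 < σ i)
    (s : κ → ℝ) {h : (κ → ℝ) → ℝ≥0∞} (hh : Measurable h) :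
    ∫⁻ e, h (s + e) * ∏ i, (likRatio (σ i) (s i + e i) (s i))⁻¹ ∂(noiseLaw σ) =
      ∫⁻ e, h e ∂(noiseLaw σ) := by
  have hm : ∀ i, Measurable fun e : ℝ => (likRatio (σ i) (s i + e) (s i))⁻¹ := by
    intro i; unfold likRatio; fun_prop
  have hm' : Measurable fun e : κ → ℝ => ∏ i, (likRatio (σ i) (s i + e i) (s i))⁻¹ :=
    Finset.measurable_prod _ fun i _ => (hm i).comp (measurable_pi_apply i)
  have hadd : Measurable fun e : κ → ℝ => s + e := by fun_prop
  have key : (((noiseLaw σ).withDensity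
      fun e => ∏ i, (likRatio (σ i) (s i + e i) (s i))⁻¹).map (fun e => s + e)) = noiseLaw σ := by
    symm
    refine Measure.pi_eq fun E hE => ?_
    rw [Measure.map_apply hadd (MeasurableSet.univ_pi hE),
      withDensity_apply _ (hadd (MeasurableSet.univ_pi hE)),
      ← lintegral_indicator (hadd (MeasurableSet.univ_pi hE))]
    have : ∀ e : κ → ℝ, ((fun e => s + e) ⁻¹' Set.univ.pi E).indicator
        (fun e => ∏ i, (likRatio (σ i) (s i + e i) (s i))⁻¹) e =
        ∏ i, ((E i).indicator 1 (s i + e i) * (likRatio (σ i) (s i + e i) (s i))⁻¹) := by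
      intro e
      rw [Finset.prod_mul_distrib]
      by_cases he : s + e ∈ Set.univ.pi E
      · rw [Set.indicator_of_mem (show e ∈ (fun e => s + e) ⁻¹' Set.univ.pi E from he)]
        have : ∀ i, (E i).indicator (1 : ℝ → ℝ≥0∞) (s i + e i) = 1 := fun i =>
          Set.indicator_of_mem (he i (Set.mem_univ i)) _
        simp [this]
      · rw [Set.indicator_of_notMem (show e ∉ (fun e => s + e) ⁻¹' Set.univ.pi E from he)]
        simp only [Set.mem_pi, Set.mem_univ, true_imp_iff, not_forall] at he
        obtain ⟨i, hi⟩ := he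
        rw [Finset.prod_eq_zero (Finset.mem_univ i) (Set.indicator_of_notMem hi _), zero_mul]
    simp_rw [this]
    rw [noiseLaw, lintegral_pi_prod
      (fun i => gaussianReal 0 (Real.toNNReal (σ i ^ 2))) (f := fun i e =>
      (E i).indicator 1 (s i + e) * (likRatio (σ i) (s i + e) (s i))⁻¹)]
    · refine Finset.prod_congr rfl fun i _ => ?_
      rw [lintegral_shift_gaussianReal (hσ i) (s i) (measurable_one.indicator (hE i)),
        lintegral_indicator_one (hE i)]
    · intro i
      exact ((measurable_one.indicator (hE i)).comp (measurable_const_add _)).mul (hm i)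
  conv_rhs => rw [← key]
  rw [lintegral_map hh hadd]
  refine Eq.trans ?_ (lintegral_withDensity_eq_lintegral_mul _ hm' (hh.comp hadd)).symm
  exact lintegral_congr fun e => mul_comm _ _

/-- Let `ε` be Gaussian noise independent of `𝓑`. Weighted by the inverse likelihood of the
`𝓑`-measurable shift `s`, the shifted noise `s + ε` is independent of `𝓑` and distributed
as `ε`. -/
lemma lintegral_shift_of_indep {Ω : Type*} {𝓑 mΩ : MeasurableSpace Ω} {P : Measure Ω}
    [IsProbabilityMeasure P] (h𝓑 : 𝓑 ≤ mΩ) {κ : Type*} [Fintype κ] {σ : κ → ℝ}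
    (hσ : ∀ i, 0 < σ i) {ε : Ω → κ → ℝ} (hε : Measurable ε)
    (hind : Indep 𝓑 (MeasurableSpace.comap ε inferInstance) P) (hlaw : P.map ε = noiseLaw σ)
    {g : Ω → ℝ≥0∞} (hg : Measurable[𝓑] g) {s : Ω → κ → ℝ} (hs : Measurable[𝓑] s)
    {h : (κ → ℝ) → ℝ≥0∞} (hh : Measurable h) :
    ∫⁻ ω, g ω * (h (s ω + ε ω) * ∏ i, (likRatio (σ i) (s ω i + ε ω i) (s ω i))⁻¹) ∂P =
      (∫⁻ ω, g ω ∂P) * ∫⁻ e, h e ∂(noiseLaw σ) := by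
  have hgs : Measurable[𝓑] fun ω => (g ω, s ω) := hg.prodMk hs
  have hgsm : Measurable fun ω => (g ω, s ω) := hgs.mono h𝓑 le_rfl
  have hif : IndepFun (fun ω => (g ω, s ω)) ε P :=
    indep_of_indep_of_le_left hind hgs.comap_le
  have hlr : ∀ i, Measurable fun p : (ℝ≥0∞ × (κ → ℝ)) × (κ → ℝ) =>
      (likRatio (σ i) (p.1.2 i + p.2 i) (p.1.2 i))⁻¹ := by
    intro i; unfold likRatio; fun_prop
  have hF : Measurable fun p : (ℝ≥0∞ × (κ → ℝ)) × (κ → ℝ) =>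
      p.1.1 * (h (p.1.2 + p.2) * ∏ i, (likRatio (σ i) (p.1.2 i + p.2 i) (p.1.2 i))⁻¹) := by
    have := Finset.measurable_prod Finset.univ fun i _ => hlr i
    exact measurable_fst.fst.mul
      ((hh.comp (measurable_fst.snd.add measurable_snd)).mul this)
  have hmap := (indepFun_iff_map_prod_eq_prod_map_map hgsm.aemeasurable hε.aemeasurable).1 hif
  calc _ = ∫⁻ p, p.1.1 * (h (p.1.2 + p.2) *
        ∏ i, (likRatio (σ i) (p.1.2 i + p.2 i) (p.1.2 i))⁻¹)
        ∂(P.map fun ω => ((g ω, s ω), ε ω)) := (lintegral_map hF (hgsm.prodMk hε)).symm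
    _ = ∫⁻ q, ∫⁻ e, q.1 * (h (q.2 + e) * ∏ i, (likRatio (σ i) (q.2 i + e i) (q.2 i))⁻¹)
        ∂(noiseLaw σ) ∂(P.map fun ω => (g ω, s ω)) := by
      rw [hmap, hlaw]
      exact lintegral_prod _ hF.aemeasurable
    _ = ∫⁻ q, q.1 * ∫⁻ e, h e ∂(noiseLaw σ) ∂(P.map fun ω => (g ω, s ω)) := by
      refine lintegral_congr fun q => ?_
      rw [← lintegral_shift_noiseLaw hσ q.2 hh, lintegral_const_mul]
      have := Finset.measurable_prod Finset.univ fun i _ =>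
        (hlr i).comp (measurable_prodMk_left (x := q))
      exact (hh.comp (measurable_const_add _)).mul this
    _ = _ := by
      rw [lintegral_mul_const _ measurable_fst, lintegral_map measurable_fst hgsm]

/-! ### Decoupling the field from the data -/

/-- Under the measure with density `W` with respect to `P`, the σ-algebra `𝓓` is independent of `𝒜`
and keeps the law that it has under `P`. -/
def Decoupled {Ω : Type*} {mΩ : MeasurableSpace Ω} (P : Measure Ω) (W : Ω → ℝ≥0∞)
    (𝓓 𝒜 : MeasurableSpace Ω) : Prop :=
  ∀ A B, MeasurableSet[𝓓] A → MeasurableSet[𝒜] B →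
    ∫⁻ ω in A ∩ B, W ω ∂P = P A * ∫⁻ ω in B, W ω ∂P

lemma setLIntegral_eq_indicator_mul {Ω : Type*} {mΩ : MeasurableSpace Ω} (P : Measure Ω)
    {A : Set Ω} (hA : MeasurableSet A) (W : Ω → ℝ≥0∞) :
    ∫⁻ ω in A, W ω ∂P = ∫⁻ ω, A.indicator 1 ω * W ω ∂P := by
  rw [← lintegral_indicator hA]
  refine lintegral_congr fun ω => ?_
  by_cases h : ω ∈ A <;> simp [h]

lemma measurable_indicator_one_mul {Ω : Type*} {m : MeasurableSpace Ω} {A : Set Ω}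
    (hA : MeasurableSet A) {W : Ω → ℝ≥0∞} (hW : Measurable W) :
    Measurable fun ω => A.indicator 1 ω * W ω :=
  (measurable_one.indicator hA).mul hW

/-- Decoupling survives further measurements `y = s + ε`, whose signal `s` may depend on the field
and on all earlier data. -/
lemma Decoupled.measure {Ω : Type*} {𝓓 𝒜 𝓑 mΩ : MeasurableSpace Ω} {P : Measure Ω}
    [IsProbabilityMeasure P] (h𝓑 : 𝓑 ≤ mΩ) (h𝓓 : 𝓓 ≤ 𝓑) (h𝒜 : 𝒜 ≤ 𝓑)
    {W : Ω → ℝ≥0∞} (hW : Measurable[𝓑] W) (hW1 : ∫⁻ ω, W ω ∂P = 1) (hdec : Decoupled P W 𝓓 𝒜)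
    {κ : Type*} [Fintype κ] {σ : κ → ℝ}
    (hσ : ∀ i, 0 < σ i) {ε : Ω → κ → ℝ} (hε : Measurable ε)
    (hind : Indep 𝓑 (MeasurableSpace.comap ε inferInstance) P) (hlaw : P.map ε = noiseLaw σ)
    {s : Ω → κ → ℝ} (hs : Measurable[𝓑] s) :
    (∫⁻ ω, W ω * ∏ i, (likRatio (σ i) (s ω i + ε ω i) (s ω i))⁻¹ ∂P = 1) ∧
    Decoupled P (fun ω => W ω * ∏ i, (likRatio (σ i) (s ω i + ε ω i) (s ω i))⁻¹) 𝓓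
      (𝒜 ⊔ MeasurableSpace.comap (fun ω => s ω + ε ω) inferInstance) := by
  set W' : Ω → ℝ≥0∞ := fun ω => W ω * ∏ i, (likRatio (σ i) (s ω i + ε ω i) (s ω i))⁻¹ with hW'
  have hy : Measurable fun ω => s ω + ε ω := (hs.mono h𝓑 le_rfl).add hε
  -- total weight of a rectangle
  have rect : ∀ A B, MeasurableSet[𝓓] A → MeasurableSet[𝒜] B → ∀ E, MeasurableSet E →
      ∫⁻ ω in A ∩ (B ∩ (fun ω => s ω + ε ω) ⁻¹' E), W' ω ∂P =
        P A * (∫⁻ ω in B, W ω ∂P) * noiseLaw σ E := by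
    intro A B hA hB E hE
    have hAB : MeasurableSet[𝓑] (A ∩ B) := (h𝓓 _ hA).inter (h𝒜 _ hB)
    rw [← hdec A B hA hB, setLIntegral_eq_indicator_mul _ (h𝓑 _ hAB), ← lintegral_indicator_one hE,
      ← lintegral_shift_of_indep h𝓑 hσ hε hind hlaw
        (measurable_indicator_one_mul hAB hW) hs (measurable_one.indicator hE),
      ← Set.inter_assoc, setLIntegral_eq_indicator_mul _ ((h𝓑 _ hAB).inter (hy hE))]
    refine lintegral_congr fun ω => ?_
    rw [Set.inter_indicator_one]
    simp only [Pi.mul_apply, hW']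
    have : ((fun ω => s ω + ε ω) ⁻¹' E).indicator (1 : Ω → ℝ≥0∞) ω =
      E.indicator 1 (s ω + ε ω) := rfl
    rw [this]; ring
  have tot : ∫⁻ ω, W' ω ∂P = 1 := by
    have := rect Set.univ Set.univ MeasurableSet.univ MeasurableSet.univ Set.univ MeasurableSet.univ
    simpa [hW1] using this
  refine ⟨tot, ?_⟩
  intro A B' hA hB'
  set 𝒜' := 𝒜 ⊔ MeasurableSpace.comap (fun ω => s ω + ε ω) inferInstance with h𝒜'
  have hle : 𝒜' ≤ mΩ := sup_le (h𝒜.trans h𝓑) hy.comap_le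
  have hAm : MeasurableSet[mΩ] A := h𝓑 _ (h𝓓 _ hA)
  have hfin : IsFiniteMeasure (P.withDensity W') := isFiniteMeasure_withDensity (by simp [tot])
  let μ₁ : @Measure Ω 𝒜' := ((P.withDensity W').restrict A).trim hle
  let μ₂ : @Measure Ω 𝒜' := (P A • P.withDensity W').trim hle
  have hPA : P A ≠ ∞ := measure_ne_top _ _
  have happ : ∀ C, MeasurableSet[𝒜'] C → μ₁ C = ∫⁻ ω in A ∩ C, W' ω ∂P ∧
      μ₂ C = P A * ∫⁻ ω in C, W' ω ∂P := by
    intro C hC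
    have hCm := hle _ hC
    refine ⟨?_, ?_⟩
    · rw [trim_measurableSet_eq hle hC, Measure.restrict_apply hCm,
        withDensity_apply _ (hCm.inter hAm), Set.inter_comm]
    · rw [trim_measurableSet_eq hle hC, Measure.smul_apply, withDensity_apply _ hCm, smul_eq_mul]
  have hf1 : @IsFiniteMeasure Ω 𝒜' μ₁ := isFiniteMeasure_trim hle
  let π : Set (Set Ω) := {C | ∃ B E, MeasurableSet[𝒜] B ∧ MeasurableSet E ∧
    C = B ∩ (fun ω => s ω + ε ω) ⁻¹' E}
  have hgen : 𝒜' = MeasurableSpace.generateFrom π := by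
    apply le_antisymm
    · refine sup_le ?_ ?_
      · intro B hB
        exact MeasurableSpace.measurableSet_generateFrom ⟨B, Set.univ, hB, MeasurableSet.univ,
          by simp⟩
      · rintro _ ⟨E, hE, rfl⟩
        exact MeasurableSpace.measurableSet_generateFrom ⟨Set.univ, E, MeasurableSet.univ, hE,
          by simp⟩
    · refine MeasurableSpace.generateFrom_le ?_
      rintro _ ⟨B, E, hB, hE, rfl⟩
      exact MeasurableSet.inter (le_sup_left (a := 𝒜) _ hB)
        (le_sup_right (a := 𝒜) _ ⟨E, hE, rfl⟩)
  have hpi : IsPiSystem π := by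
    rintro _ ⟨B, E, hB, hE, rfl⟩ _ ⟨B₂, E₂, hB₂, hE₂, rfl⟩ -
    refine ⟨B ∩ B₂, E ∩ E₂, hB.inter hB₂, hE.inter hE₂, ?_⟩
    ext ω; simp only [Set.mem_inter_iff, Set.mem_preimage]; tauto
  have hπ : ∀ C ∈ π, μ₁ C = μ₂ C := by
    rintro C hC
    have hCm : MeasurableSet[𝒜'] C := by
      rw [hgen]; exact MeasurableSpace.measurableSet_generateFrom hC
    rw [(happ C hCm).1, (happ C hCm).2]
    obtain ⟨B, E, hB, hE, rfl⟩ := hC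
    rw [rect A B hA hB E hE]
    have := rect Set.univ B MeasurableSet.univ hB E hE
    rw [Set.univ_inter] at this
    rw [this, measure_univ, one_mul, mul_assoc]
  have := @ext_of_generate_finite Ω 𝒜' μ₁ μ₂ π hgen hpi hf1 hπ (hπ _ ⟨Set.univ, Set.univ,
    MeasurableSet.univ, MeasurableSet.univ, by simp⟩)
  rw [← (happ B' hB').1, ← (happ B' hB').2, this]

lemma lintegral_diag_of_indep {Ω E F : Type*} {mΩ : MeasurableSpace Ω} [MeasurableSpace E]
    [MeasurableSpace F] (Q : Measure Ω) [IsFiniteMeasure Q] (μ : Measure E) [IsFiniteMeasure μ]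
    {X : Ω → E} {Y : Ω → F} (hX : Measurable X) (hY : Measurable Y)
    (h : ∀ A B, MeasurableSet A → MeasurableSet B → Q (X ⁻¹' A ∩ Y ⁻¹' B) = μ A * Q (Y ⁻¹' B))
    {H : E × F → ℝ≥0∞} (hH : Measurable H) :
    ∫⁻ ω, H (X ω, Y ω) ∂Q = ∫⁻ ω, ∫⁻ x, H (x, Y ω) ∂μ ∂Q := by
  have key : Q.map (fun ω => (X ω, Y ω)) = μ.prod (Q.map Y) := by
    symm
    refine Measure.prod_eq fun A B hA hB => ?_
    rw [Measure.map_apply (hX.prodMk hY) (hA.prod hB), Measure.map_apply hY hB, ← h A B hA hB]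
    rfl
  rw [← lintegral_map hH (hX.prodMk hY), key, lintegral_prod_symm _ hH.aemeasurable,
    lintegral_map hH.lintegral_prod_left' hY]

/-- If the field is decoupled from the data, then it may be replaced by an independent copy. -/
lemma Decoupled.lintegral_diag {Ω : Type*} {𝓓 𝒜 mΩ : MeasurableSpace Ω} {P : Measure Ω}
    [IsProbabilityMeasure P] (h𝓓 : 𝓓 ≤ mΩ) (h𝒜 : 𝒜 ≤ mΩ)
    {W : Ω → ℝ≥0∞} (hW : Measurable W) (hW1 : ∫⁻ ω, W ω ∂P = 1) (hdec : Decoupled P W 𝓓 𝒜)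
    {H : Ω × Ω → ℝ≥0∞} (hH : Measurable[𝓓.prod 𝒜] H) :
    ∫⁻ ω, W ω * H (ω, ω) ∂P = ∫⁻ ω, W ω * ∫⁻ ω', H (ω', ω) ∂P ∂P := by
  have hfin : IsFiniteMeasure (P.withDensity W) := isFiniteMeasure_withDensity (by simp [hW1])
  have hfin' : @IsFiniteMeasure Ω 𝓓 (P.trim h𝓓) := isFiniteMeasure_trim h𝓓
  have hle : 𝓓.prod 𝒜 ≤ mΩ.prod mΩ :=
    sup_le_sup (MeasurableSpace.comap_mono h𝓓) (MeasurableSpace.comap_mono h𝒜)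
  have hH' : Measurable[mΩ.prod mΩ] H := hH.mono hle le_rfl
  have := @lintegral_diag_of_indep Ω Ω Ω mΩ 𝓓 𝒜 (P.withDensity W) hfin (P.trim h𝓓) hfin'
    id id (measurable_id'' h𝓓) (measurable_id'' h𝒜) (by
      intro A B hA hB
      rw [Set.preimage_id, Set.preimage_id, withDensity_apply _ ((h𝓓 _ hA).inter (h𝒜 _ hB)),
        withDensity_apply _ (h𝒜 _ hB), hdec A B hA hB, trim_measurableSet_eq h𝓓 hA]) H hH
  have hdiag : Measurable fun ω => H (ω, ω) := hH'.comp (measurable_id.prodMk measurable_id)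
  have hin : ∀ ω, ∫⁻ x, H (x, ω) ∂(P.trim h𝓓) = ∫⁻ x, H (x, ω) ∂P := fun ω =>
    lintegral_trim h𝓓 (@Measurable.comp Ω (Ω × Ω) _ 𝓓 (𝓓.prod 𝒜) _ _ _ hH
      (@measurable_prodMk_right Ω Ω 𝓓 𝒜 ω))
  simp only [id, hin] at this
  rw [lintegral_withDensity_eq_lintegral_mul _ hW hdiag,
    lintegral_withDensity_eq_lintegral_mul _ hW (hH'.lintegral_prod_left')] at this
  exact this

/-! ### Gaussian posterior for a fixed design -/

lemma lintegral_exp_mul_gaussianReal (m : ℝ) (v : ℝ≥0) (θ : ℝ) {f : ℝ → ℝ≥0∞}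
    (hf : Measurable f) :
    ∫⁻ x, ENNReal.ofReal (Real.exp (θ * (x - m) - θ ^ 2 * v / 2)) * f x ∂(gaussianReal m v) =
      ∫⁻ x, f (x + θ * v) ∂(gaussianReal m v) := by
  rcases eq_or_ne v 0 with rfl | hv
  · rw [gaussianReal_zero_var, lintegral_dirac' _ (by fun_prop), lintegral_dirac' _ (by fun_prop)]
    simp
  have hv' : (0 : ℝ) < v := by positivity
  have hσ : 0 < Real.sqrt v := Real.sqrt_pos.2 hv'
  have hsq : Real.toNNReal (Real.sqrt v ^ 2) = v := by
    rw [Real.sq_sqrt hv'.le, Real.toNNReal_coe]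
  have hmap : gaussianReal m v = (gaussianReal 0 v).map (fun x => m + x) := by
    rw [gaussianReal_map_const_add, zero_add]
  have hl : Measurable fun p => likRatio (Real.sqrt v) p (θ * v) := by
    unfold likRatio; fun_prop
  have h := lintegral_shift_gaussianReal hσ (θ * v)
    (h := fun x => likRatio (Real.sqrt v) x (θ * v) * f (m + x)) (by fun_prop)
  rw [hsq] at h
  rw [hmap, lintegral_map (by fun_prop) (by fun_prop), lintegral_map (by fun_prop) (by fun_prop)]
  refine Eq.trans ?_ (h.symm.trans ?_)
  · refine lintegral_congr fun x => ?_
    congr 3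
    rw [Real.sq_sqrt hv'.le]
    field_simp
    ring
  · refine lintegral_congr fun x => ?_
    rw [mul_comm, ← mul_assoc,
      ENNReal.inv_mul_cancel (likRatio_ne_zero _ _ _) (likRatio_ne_top _ _ _), one_mul]
    congr 1
    ring

section Gaussian

variable {Ω : Type*} {mΩ : MeasurableSpace Ω} {P : Measure Ω}
  {ι : Type*} [Fintype ι]

/-- Cameron–Martin formula for Gaussian vectors: tilting by the component `W` shifts every component
by its covariance with `W`. -/
lemma HasGaussianLaw.lintegral_tilt {W : Ω → ℝ} {U : ι → Ω → ℝ}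
    (hG : HasGaussianLaw (fun ω => (W ω, fun a => U a ω)) P) (hW : Measurable W)
    (hU : ∀ a, Measurable (U a)) (θ : ℝ) {F : ℝ × (ι → ℝ) → ℝ≥0∞} (hF : Measurable F) :
    ∫⁻ ω, ENNReal.ofReal (Real.exp (θ * (W ω - P[W]) - θ ^ 2 * Var[W; P] / 2)) *
        F (W ω, fun a => U a ω) ∂P =
      ∫⁻ ω, F (W ω + θ * Var[W; P], fun a => U a ω + θ * cov[U a, W; P]) ∂P := by
  have hprob : IsProbabilityMeasure P := hG.isProbabilityMeasure
  have hWG : HasGaussianLaw W P := hG.fst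
  have hUG : ∀ a, HasGaussianLaw (U a) P := fun a => hG.snd.eval a
  set v := Var[W; P] with hv
  have hv0 : 0 ≤ v := variance_nonneg _ _
  set c : ι → ℝ := fun a => cov[U a, W; P] with hc
  have hcv : ∀ a, c a / v * v = c a := by
    intro a
    rcases eq_or_ne v 0 with h0 | h0
    · have hae : W =ᵐ[P] fun _ => P[W] := ae_eq_integral_of_variance_eq_zero hWG.memLp_two h0
      have : c a = 0 := by
        simp only [hc, covariance]
        rw [integral_eq_zero_of_ae]
        filter_upwards [hae] with ω hω
        simp [hω]
      simp [this]
    · exact div_mul_cancel₀ _ h0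
  -- the part of `U` that is independent of `W`
  let R : ι → Ω → ℝ := fun a ω => U a ω - c a / v * W ω
  have hR : ∀ a, Measurable (R a) := fun a => (hU a).sub (hW.const_mul _)
  have hRG : HasGaussianLaw (fun ω => (fun (_ : Unit) => W ω, fun a => R a ω)) P := by
    let L : (ℝ × (ι → ℝ)) →L[ℝ] ((Unit → ℝ) × (ι → ℝ)) :=
      (ContinuousLinearMap.pi fun _ => ContinuousLinearMap.fst ℝ ℝ (ι → ℝ)).prod
        (ContinuousLinearMap.pi fun a =>
          (ContinuousLinearMap.proj a).comp (ContinuousLinearMap.snd ℝ ℝ (ι → ℝ)) -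
            (c a / v) • ContinuousLinearMap.fst ℝ ℝ (ι → ℝ))
    exact hG.map_fun L
  have hind : IndepFun (fun ω (_ : Unit) => W ω) (fun ω a => R a ω) P := by
    refine HasGaussianLaw.indepFun_of_covariance_eval (X := fun _ => W) (Y := R) hRG fun _ a => ?_
    rw [covariance_comm]
    simp only [R]
    rw [covariance_fun_sub_left (hUG a).memLp_two (hWG.memLp_two.const_mul _) hWG.memLp_two,
      covariance_const_mul_left, covariance_self hWG.aemeasurable, ← hv, hcv, sub_self]
  have hind' : IndepFun W (fun ω a => R a ω) P :=
    hind.comp (φ := fun f : Unit → ℝ => f ()) (measurable_pi_apply _) measurable_id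
  have hRm : Measurable fun ω a => R a ω := measurable_pi_lambda _ hR
  have hmap := (indepFun_iff_map_prod_eq_prod_map_map hW.aemeasurable hRm.aemeasurable).1 hind'
  have hWlaw : P.map W = gaussianReal P[W] v.toNNReal := hWG.map_eq_gaussianReal
  have : IsProbabilityMeasure (P.map fun ω a => R a ω) :=
    Measure.isProbabilityMeasure_map hRm.aemeasurable
  let J : ℝ × (ι → ℝ) → ℝ × (ι → ℝ) := fun p => (p.1, fun a => p.2 a + c a / v * p.1)
  have hJ : Measurable J := by
    refine measurable_fst.prodMk (measurable_pi_lambda _ fun a => ?_)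
    fun_prop
  have hFJ : Measurable fun p => F (J p) := hF.comp hJ
  let e : ℝ → ℝ≥0∞ := fun x => ENNReal.ofReal (Real.exp (θ * (x - P[W]) - θ ^ 2 * v / 2))
  have he : Measurable e := by simp only [e]; fun_prop
  have hUJ : ∀ ω, (W ω, fun a => U a ω) = J (W ω, fun a => R a ω) := by
    intro ω; simp [J, R]
  have hUJ' : ∀ ω, (W ω + θ * v, fun a => U a ω + θ * c a) = J (W ω + θ * v, fun a => R a ω) := by
    intro ω
    simp only [J, R, Prod.mk.injEq, true_and]
    funext a
    conv_lhs => rw [← hcv a]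
    ring
  calc _ = ∫⁻ ω, e (W ω) * F (J (W ω, fun a => R a ω)) ∂P := by
        refine lintegral_congr fun ω => ?_
        rw [hUJ]
    _ = ∫⁻ p, e p.1 * F (J p) ∂(P.map fun ω => (W ω, fun a => R a ω)) :=
        (lintegral_map (f := fun p => e p.1 * F (J p)) ((he.comp measurable_fst).mul hFJ)
          (hW.prodMk hRm)).symm
    _ = ∫⁻ r, ∫⁻ x, e x * F (J (x, r)) ∂(gaussianReal P[W] v.toNNReal)
          ∂(P.map fun ω a => R a ω) := by
        rw [hmap, hWlaw]
        exact lintegral_prod_symm _ ((he.comp measurable_fst).mul hFJ).aemeasurable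
    _ = ∫⁻ r, ∫⁻ x, F (J (x + θ * v, r)) ∂(gaussianReal P[W] v.toNNReal)
          ∂(P.map fun ω a => R a ω) := by
        refine lintegral_congr fun r => ?_
        have := lintegral_exp_mul_gaussianReal P[W] v.toNNReal θ
          (f := fun x => F (J (x, r))) (hFJ.comp measurable_prodMk_right)
        rw [Real.coe_toNNReal _ hv0] at this
        exact this
    _ = ∫⁻ p, F (J (p.1 + θ * v, p.2)) ∂(P.map fun ω => (W ω, fun a => R a ω)) := by
        rw [hmap, hWlaw]
        exact (lintegral_prod_symm (fun p : ℝ × (ι → ℝ) => F (J (p.1 + θ * v, p.2)))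
          (hFJ.comp (by fun_prop)).aemeasurable).symm
    _ = ∫⁻ ω, F (J (W ω + θ * v, fun a => R a ω)) ∂P :=
        lintegral_map (f := fun p : ℝ × (ι → ℝ) => F (J (p.1 + θ * v, p.2)))
          (hFJ.comp (by fun_prop)) (hW.prodMk hRm)
    _ = _ := by
        refine lintegral_congr fun ω => ?_
        rw [← hUJ']

omit [Fintype ι] in
lemma measure_eq_gaussianReal_of_lintegral_exp {μ : Measure ℝ} [IsProbabilityMeasure μ] {m : ℝ}
    {v : ℝ≥0} (h : ∀ θ : ℝ, ∫⁻ x, ENNReal.ofReal (Real.exp (θ * x)) ∂μ =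
      ENNReal.ofReal (Real.exp (m * θ + v * θ ^ 2 / 2))) : μ = gaussianReal m v := by
  have hmgf : mgf id (gaussianReal m v) = mgf id μ := by
    rw [mgf_id_gaussianReal]
    funext θ
    simp only [mgf, id]
    rw [integral_eq_lintegral_of_nonneg_ae (ae_of_all _ fun x => (Real.exp_pos _).le)
      (by fun_prop), h, ENNReal.toReal_ofReal (Real.exp_pos _).le]
  have := eqOn_complexMGF_of_mgf hmgf
  rw [integrableExpSet_id_gaussianReal] at this
  refine (Measure.ext_of_complexMGF_id_eq ?_).symm
  funext z
  exact this (by simp)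

/-- Likelihood of the noisy measurements `y` of the signals `u`. -/
def lik (σ y u : ι → ℝ) : ℝ≥0∞ := ∏ a, likRatio (σ a) (y a) (u a)

lemma lik_eq (σ y u : ι → ℝ) : lik σ y u =
    ENNReal.ofReal (Real.exp (∑ a, (2 * y a * u a - u a ^ 2) / (2 * σ a ^ 2))) := by
  rw [Real.exp_sum, ENNReal.ofReal_prod_of_nonneg fun a _ => (Real.exp_pos _).le]
  rfl

lemma measurable_lik (σ y : ι → ℝ) : Measurable (lik σ y) := by
  simp_rw [funext (lik_eq σ y)]
  fun_prop

lemma lik_ne_zero (σ y u : ι → ℝ) : lik σ y u ≠ 0 := by simp [lik_eq, Real.exp_pos]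

lemma lik_ne_top (σ y u : ι → ℝ) : lik σ y u ≠ ∞ := by simp [lik_eq]

lemma lik_le (σ y u : ι → ℝ) : lik σ y u ≤
    ENNReal.ofReal (Real.exp (∑ a, (y a ^ 2) / (2 * σ a ^ 2))) := by
  rw [lik_eq]
  gcongr with a
  nlinarith [sq_nonneg (y a - u a)]

lemma lintegral_lik_ne_zero [IsProbabilityMeasure P] {U : ι → Ω → ℝ} (hU : ∀ a, Measurable (U a))
    (σ y : ι → ℝ) : ∫⁻ ω, lik σ y (fun a => U a ω) ∂P ≠ 0 := by
  refine ne_of_gt ((lintegral_pos_iff_support ?_).2 ?_)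
  · exact (measurable_lik σ y).comp (measurable_pi_lambda _ hU)
  · have : Function.support (fun ω => lik σ y fun a => U a ω) = Set.univ := by
      ext ω; simp [lik_ne_zero]
    simp [this]

lemma lintegral_lik_ne_top [IsProbabilityMeasure P] (U : ι → Ω → ℝ)
    (σ y : ι → ℝ) : ∫⁻ ω, lik σ y (fun a => U a ω) ∂P ≠ ∞ := by
  refine ne_top_of_le_ne_top ?_ (lintegral_mono fun ω => lik_le σ y _)
  simp

/-- Conditioning a Gaussian vector on noisy measurements of its components `U`: reweighted by the
likelihood, the component `V` is Gaussian. The weights `w` solve the normal equations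
`(K + Θ) w = k`. -/
theorem HasGaussianLaw.posterior {V : Ω → ℝ} {U : ι → Ω → ℝ}
    (hG : HasGaussianLaw (fun ω => (V ω, fun a => U a ω)) P) (hV : Measurable V)
    (hU : ∀ a, Measurable (U a)) {σ : ι → ℝ} (hσ : ∀ a, 0 < σ a) (y w : ι → ℝ)
    (hw : ∀ a, ∑ b, cov[U a, U b; P] * w b + σ a ^ 2 * w a = cov[U a, V; P]) :
    0 ≤ Var[V; P] - ∑ a, w a * cov[U a, V; P] ∧
    ∀ E, MeasurableSet E → ∫⁻ ω in V ⁻¹' E, lik σ y (fun a => U a ω) ∂P =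
      (∫⁻ ω, lik σ y (fun a => U a ω) ∂P) *
        gaussianReal (P[V] + ∑ a, w a * (y a - P[U a]))
          (Real.toNNReal (Var[V; P] - ∑ a, w a * cov[U a, V; P])) E := by
  have hprob : IsProbabilityMeasure P := hG.isProbabilityMeasure
  have hVG : HasGaussianLaw V P := hG.fst
  have hUG : ∀ a, HasGaussianLaw (U a) P := fun a => hG.snd.eval a
  have hV2 := hVG.memLp_two
  have hU2 : ∀ a, MemLp (U a) 2 P := fun a => (hUG a).memLp_two
  set W : Ω → ℝ := fun ω => V ω - ∑ a, w a * U a ω with hWdef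
  have hsum2 : MemLp (fun ω => ∑ a, w a * U a ω) 2 P :=
    memLp_finsetSum _ fun a _ => (hU2 a).const_mul _
  have hW : Measurable W := hV.sub (Finset.measurable_sum _ fun a _ => (hU a).const_mul _)
  have hWG : HasGaussianLaw (fun ω => (W ω, fun a => U a ω)) P := by
    let L : (ℝ × (ι → ℝ)) →L[ℝ] (ℝ × (ι → ℝ)) :=
      (ContinuousLinearMap.fst ℝ ℝ (ι → ℝ) - ∑ a, w a •
        (ContinuousLinearMap.proj a).comp (ContinuousLinearMap.snd ℝ ℝ (ι → ℝ))).prod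
        (ContinuousLinearMap.snd ℝ ℝ (ι → ℝ))
    have hL : (fun ω => (W ω, fun a => U a ω)) = fun ω => L (V ω, fun a => U a ω) := by
      funext ω; simp [L, hWdef]
    rw [hL]
    exact hG.map_fun L
  have hcov : ∀ a, cov[U a, W; P] = σ a ^ 2 * w a := by
    intro a
    rw [hWdef, covariance_fun_sub_right (hU2 a) hV2 hsum2,
      covariance_fun_sum_right (fun b => (hU2 b).const_mul _) (hU2 a), ← hw a]
    simp_rw [covariance_const_mul_right, mul_comm (w _)]
    ring
  have hvar : Var[W; P] = Var[V; P] - ∑ a, w a * cov[U a, V; P] - ∑ a, σ a ^ 2 * w a ^ 2 := by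
    have hW2 : MemLp W 2 P := hV2.sub hsum2
    rw [← covariance_self hWG.fst.aemeasurable]
    conv_lhs => rw [hWdef]
    rw [covariance_fun_sub_left hV2 hsum2 hW2,
      covariance_fun_sum_left (fun b => (hU2 b).const_mul _) hW2]
    simp_rw [covariance_const_mul_left, hcov]
    rw [hWdef, covariance_fun_sub_right hV2 hV2 hsum2, covariance_self hVG.aemeasurable,
      covariance_fun_sum_right (fun b => (hU2 b).const_mul _) hV2]
    simp_rw [covariance_const_mul_right, covariance_comm V]
    congr 1
    refine Finset.sum_congr rfl fun a _ => ?_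
    ring
  have hmean : P[W] = P[V] - ∑ a, w a * P[U a] := by
    rw [hWdef, integral_sub (hVG.integrable)
      (integrable_finsetSum _ fun a _ => ((hUG a).integrable.const_mul _)),
      integral_finsetSum _ fun a _ => ((hUG a).integrable.const_mul _)]
    simp_rw [integral_const_mul]
  set v' := Var[V; P] - ∑ a, w a * cov[U a, V; P] with hv'
  set m' := P[V] + ∑ a, w a * (y a - P[U a]) with hm'
  have hv'0 : 0 ≤ v' := by
    have h1 := variance_nonneg W P
    have h2 : 0 ≤ ∑ a, σ a ^ 2 * w a ^ 2 := Finset.sum_nonneg fun a _ => by positivity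
    linarith
  refine ⟨hv'0, ?_⟩
  set Λ : Ω → ℝ≥0∞ := fun ω => lik σ y (fun a => U a ω) with hΛ
  have hΛm : Measurable Λ := (measurable_lik σ y).comp (measurable_pi_lambda _ hU)
  set Z := ∫⁻ ω, Λ ω ∂P with hZ
  have hZ0 : Z ≠ 0 := lintegral_lik_ne_zero hU σ y
  have hZt : Z ≠ ∞ := lintegral_lik_ne_top U σ y
  -- the moment generating function of `V` under the reweighted measure
  have hexp : ∀ θ : ℝ, ∫⁻ ω, ENNReal.ofReal (Real.exp (θ * V ω)) * Λ ω ∂P =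
      ENNReal.ofReal (Real.exp (m' * θ + v' * θ ^ 2 / 2)) * Z := by
    intro θ
    let F : ℝ × (ι → ℝ) → ℝ≥0∞ := fun p => ENNReal.ofReal (Real.exp
      (θ * P[W] + θ ^ 2 * Var[W; P] / 2 + θ * ∑ a, w a * p.2 a +
        ∑ a, (2 * y a * p.2 a - p.2 a ^ 2) / (2 * σ a ^ 2)))
    have hF : Measurable F := by simp only [F]; fun_prop
    have h := HasGaussianLaw.lintegral_tilt hWG hW hU θ hF
    rw [hZ, ← lintegral_const_mul _ hΛm]
    refine Eq.trans ?_ (h.trans ?_)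
    · refine lintegral_congr fun ω => ?_
      simp only [F, hΛ, lik_eq]
      rw [← ENNReal.ofReal_mul (Real.exp_pos _).le, ← ENNReal.ofReal_mul (Real.exp_pos _).le,
        ← Real.exp_add, ← Real.exp_add]
      congr 2
      simp only [hWdef]
      ring
    · refine lintegral_congr fun ω => ?_
      simp only [F, hΛ, lik_eq, hcov]
      rw [← ENNReal.ofReal_mul (Real.exp_pos _).le, ← Real.exp_add]
      congr 2
      have hterm : ∀ a, (2 * y a * (U a ω + θ * (σ a ^ 2 * w a)) -
          (U a ω + θ * (σ a ^ 2 * w a)) ^ 2) / (2 * σ a ^ 2) =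
          (2 * y a * U a ω - U a ω ^ 2) / (2 * σ a ^ 2) + (θ * (w a * y a) - θ * (w a * U a ω)
            - θ ^ 2 / 2 * (σ a ^ 2 * w a ^ 2)) := by
        intro a
        have := (hσ a).ne'
        field_simp
        ring
      have hterm2 : ∀ a, w a * (U a ω + θ * (σ a ^ 2 * w a)) =
          w a * U a ω + θ * (σ a ^ 2 * w a ^ 2) := fun a => by ring
      simp_rw [hterm, hterm2, Finset.sum_add_distrib, Finset.sum_sub_distrib, ← Finset.mul_sum]
      rw [hmean, hvar, hm']
      simp_rw [mul_sub, Finset.sum_sub_distrib]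
      ring
  have hden : Measurable fun ω => Λ ω / Z := hΛm.div_const _
  let ν := (P.withDensity fun ω => Λ ω / Z).map V
  have hν : IsProbabilityMeasure ν := by
    have : IsProbabilityMeasure (P.withDensity fun ω => Λ ω / Z) := by
      refine ⟨?_⟩
      rw [withDensity_apply _ MeasurableSet.univ, Measure.restrict_univ]
      simp_rw [div_eq_mul_inv]
      rw [lintegral_mul_const _ hΛm, ENNReal.mul_inv_cancel hZ0 hZt]
    exact Measure.isProbabilityMeasure_map hV.aemeasurable
  have hνeq : ν = gaussianReal m' (Real.toNNReal v') := by
    refine measure_eq_gaussianReal_of_lintegral_exp fun θ => ?_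
    rw [Real.coe_toNNReal _ hv'0, lintegral_map (by fun_prop) hV,
      lintegral_withDensity_eq_lintegral_mul _ hden (by fun_prop)]
    have : ∀ ω, ((fun ω => Λ ω / Z) * fun ω => ENNReal.ofReal (Real.exp (θ * V ω))) ω =
        (ENNReal.ofReal (Real.exp (θ * V ω)) * Λ ω) * Z⁻¹ := by
      intro ω; simp only [Pi.mul_apply, div_eq_mul_inv]; ring
    simp_rw [this]
    rw [lintegral_mul_const _ (by fun_prop), hexp, mul_assoc, ENNReal.mul_inv_cancel hZ0 hZt,
      mul_one]
  intro E hE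
  rw [← hνeq, Measure.map_apply hV hE, withDensity_apply _ (hV hE)]
  simp_rw [div_eq_mul_inv]
  rw [lintegral_mul_const _ hΛm, mul_comm, mul_assoc, ENNReal.inv_mul_cancel hZ0 hZt, mul_one]

end Gaussian

/-! ### The multi-fidelity Gaussian process -/

namespace MFModel

variable {D : Set Plane} {s : ℕ} (M : MFModel D s)

lemma ρProd_self (f : Fin (s + 1)) : M.ρProd f f = 1 := by
  unfold ρProd
  refine Finset.prod_eq_one fun i hi => ?_
  simp only [Finset.mem_filter, Finset.mem_univ, true_and] at hi
  exact absurd hi.2 (not_lt.2 hi.1)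

lemma ρProd_succ (i : Fin (s + 1)) (f : Fin s) (hi : i ≤ f.castSucc) :
    M.ρProd i f.succ = M.ρ f * M.ρProd i f.castSucc := by
  unfold ρProd
  have : (Finset.univ.filter fun j : Fin s => i ≤ j.castSucc ∧ j.castSucc < f.succ) =
      insert f (Finset.univ.filter fun j : Fin s => i ≤ j.castSucc ∧ j.castSucc < f.castSucc) := by
    ext j
    simp only [Finset.mem_filter, Finset.mem_univ, true_and, Finset.mem_insert, Fin.lt_def,
      Fin.le_def, Fin.val_castSucc, Fin.val_succ, Fin.ext_iff] at hi ⊢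
    omega
  rw [this, Finset.prod_insert (by simp)]

lemma continuous_priorMean (f : Fin (s + 1)) : Continuous (M.priorMean f) := by
  unfold priorMean
  exact continuous_finsetSum _ fun i _ => continuous_const.mul (M.mean_cont i)

lemma continuous_priorCov (f f' : Fin (s + 1)) :
    Continuous fun p : D × D => M.priorCov f f' p.1 p.2 := by
  unfold priorCov
  exact continuous_finsetSum _ fun i _ => continuous_const.mul (M.cov_cont i)

end MFModel

namespace SMLCRun.IsMFGP

variable {D : Set Plane} {s N n₀ : ℕ} {Ω : Type*} [MeasurableSpace Ω] {P : Measure Ω}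
  {R : SMLCRun D s N n₀ Ω} {M : MFModel D s}

lemma φ_eq (h : R.IsMFGP M P) (f : Fin (s + 1)) (x : D) (ω : Ω) :
    R.φ f x ω = ∑ i : Fin (s + 1) with i ≤ f, M.ρProd i f * R.δ i x ω := by
  induction f using Fin.induction with
  | zero =>
    have : (Finset.univ.filter fun i : Fin (s + 1) => i ≤ 0) = {0} := by
      ext i; simp
    rw [this, Finset.sum_singleton, M.ρProd_self, one_mul, h.level_zero]
  | succ f ih =>
    have : (Finset.univ.filter fun i : Fin (s + 1) => i ≤ f.succ) =
        insert f.succ (Finset.univ.filter fun i : Fin (s + 1) => i ≤ f.castSucc) := by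
      ext i
      simp only [Finset.mem_filter, Finset.mem_univ, true_and, Finset.mem_insert, Fin.le_def,
        Fin.val_castSucc, Fin.val_succ, Fin.ext_iff]
      omega
    rw [this, Finset.sum_insert (by simp [Fin.le_def]), M.ρProd_self, one_mul, h.level_succ, ih,
      add_comm, Finset.mul_sum]
    congr 1
    refine Finset.sum_congr rfl fun i hi => ?_
    rw [M.ρProd_succ i f (by simpa using hi), mul_assoc]

lemma measurable_φ (h : R.IsMFGP M P) (f : Fin (s + 1)) (x : D) : Measurable (R.φ f x) := by
  rw [funext fun ω => h.φ_eq f x ω]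
  exact Finset.measurable_sum _ fun i _ => (h.field_meas i x).const_mul _

lemma continuous_φ (h : R.IsMFGP M P) (f : Fin (s + 1)) (ω : Ω) :
    Continuous fun x => R.φ f x ω := by
  simp_rw [h.φ_eq]
  exact continuous_finsetSum _ fun i _ => continuous_const.mul (h.field_cont i ω)

lemma hasGaussianLaw_δ (h : R.IsMFGP M P) (f : Fin (s + 1)) (x : D) :
    HasGaussianLaw (R.δ f x) P := (h.field_gauss f).hasGaussianLaw_eval x

lemma cov_comm (h : R.IsMFGP M P) (f : Fin (s + 1)) (x x' : D) :
    M.cov f x x' = M.cov f x' x := by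
  rw [← h.field_cov, ← h.field_cov, covariance_comm]

lemma priorCov_comm (h : R.IsMFGP M P) (f f' : Fin (s + 1)) (x x' : D) :
    M.priorCov f f' x x' = M.priorCov f' f x' x := by
  unfold MFModel.priorCov
  rw [min_comm]
  refine Finset.sum_congr rfl fun i _ => ?_
  rw [h.cov_comm]
  ring

lemma iIndepFun_δ (h : R.IsMFGP M P) : iIndepFun (fun f ω x => R.δ f x ω) P := by
  rw [iIndepFun_iff_iIndep]
  exact h.indep.precomp (g := SMLCSource.field) fun a b hab => by simpa using hab

lemma covariance_δ (h : R.IsMFGP M P) (i j : Fin (s + 1)) (x x' : D) :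
    cov[R.δ i x, R.δ j x'; P] = if i = j then M.cov i x x' else 0 := by
  split_ifs with hij
  · subst hij; exact h.field_cov i x x'
  · have hind : IndepFun (R.δ i x) (R.δ j x') P :=
      (h.iIndepFun_δ.indepFun hij).comp (φ := fun g : D → ℝ => g x) (ψ := fun g : D → ℝ => g x')
        (measurable_pi_apply _) (measurable_pi_apply _)
    exact hind.covariance_eq_zero (h.hasGaussianLaw_δ i x).memLp_two
      (h.hasGaussianLaw_δ j x').memLp_two

lemma integral_φ (h : R.IsMFGP M P) (f : Fin (s + 1)) (x : D) :
    ∫ ω, R.φ f x ω ∂P = M.priorMean f x := by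
  simp_rw [h.φ_eq, MFModel.priorMean]
  rw [integral_finsetSum _ fun i _ => (h.hasGaussianLaw_δ i x).integrable.const_mul _]
  simp_rw [integral_const_mul, h.field_mean]

lemma covariance_φ (h : R.IsMFGP M P) [IsProbabilityMeasure P] (f f' : Fin (s + 1)) (x x' : D) :
    cov[R.φ f x, R.φ f' x'; P] = M.priorCov f f' x x' := by
  rw [funext fun ω => h.φ_eq f x ω, funext fun ω => h.φ_eq f' x' ω,
    covariance_fun_sum_fun_sum' (fun i _ => (h.hasGaussianLaw_δ i x).memLp_two.const_mul _)
      (fun i _ => (h.hasGaussianLaw_δ i x').memLp_two.const_mul _)]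
  simp_rw [covariance_const_mul_left, covariance_const_mul_right, h.covariance_δ,
    MFModel.priorCov, Finset.sum_filter, le_min_iff]
  refine Finset.sum_congr rfl fun i _ => ?_
  by_cases hi : i ≤ f
  · rw [if_pos hi, Finset.sum_eq_single i]
    · by_cases hi' : i ≤ f'
      · simp [hi, hi']; ring
      · simp [hi']
    · intro j _ hj
      simp [Ne.symm hj]
    · simp
  · simp [hi]

/-- The levels of the sensory function, at all points of the domain, are jointly Gaussian. -/
lemma isGaussianProcess_φ (h : R.IsMFGP M P) :
    IsGaussianProcess (fun (p : Fin (s + 1) × D) ω => R.φ p.1 p.2 ω) P where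
  hasGaussianLaw I := by
    classical
    let J : Finset D := I.image Prod.snd
    have h1 : ∀ f, HasGaussianLaw (fun ω => J.restrict (R.δ f · ω)) P := fun f =>
      (h.field_gauss f).hasGaussianLaw J
    have h2 : iIndepFun (fun f ω => J.restrict (R.δ f · ω)) P :=
      h.iIndepFun_δ.comp (fun _ => J.restrict) fun _ => by fun_prop
    have h3 := h2.hasGaussianLaw h1
    let L : (Fin (s + 1) → J → ℝ) →L[ℝ] (I → ℝ) :=
      ContinuousLinearMap.pi fun p => ∑ i : Fin (s + 1) with i ≤ p.1.1, M.ρProd i p.1.1 •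
        (ContinuousLinearMap.proj (R := ℝ) (φ := fun _ : J => ℝ)
          ⟨p.1.2, Finset.mem_image_of_mem _ p.2⟩).comp
          (ContinuousLinearMap.proj (R := ℝ) (φ := fun _ : Fin (s + 1) => J → ℝ) i)
    have hL : (fun ω => I.restrict fun p : Fin (s + 1) × D => R.φ p.1 p.2 ω) =
        fun ω => L (fun f => J.restrict (R.δ f · ω)) := by
      funext ω p
      simp [L, h.φ_eq]
    rw [hL]
    exact h3.map_fun L

/-- Joint Gaussianity in the form in which it is conditioned on measurements. -/
lemma hasGaussianLaw_sub_mul (h : R.IsMFGP M P) {ι : Type*} [Fintype ι] (lev : ι → Fin (s + 1))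
    (loc : ι → D) (f : Fin (s + 1)) (x x' : D) (c : ℝ) :
    HasGaussianLaw (fun ω => (R.φ f x ω - c * R.φ f x' ω, fun a => R.φ (lev a) (loc a) ω)) P := by
  classical
  let I : Finset (Fin (s + 1) × D) :=
    {(f, x), (f, x')} ∪ Finset.univ.image fun a => (lev a, loc a)
  have hx : (f, x) ∈ I := by simp [I]
  have hx' : (f, x') ∈ I := by simp [I]
  have ha : ∀ a, (lev a, loc a) ∈ I := fun a =>
    Finset.mem_union_right _ (Finset.mem_image_of_mem _ (Finset.mem_univ a))
  let L : (I → ℝ) →L[ℝ] (ℝ × (ι → ℝ)) :=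
    (ContinuousLinearMap.proj (R := ℝ) (φ := fun _ : I => ℝ) ⟨_, hx⟩ -
      c • ContinuousLinearMap.proj (R := ℝ) (φ := fun _ : I => ℝ) ⟨_, hx'⟩).prod
      (ContinuousLinearMap.pi fun a =>
        ContinuousLinearMap.proj (R := ℝ) (φ := fun _ : I => ℝ) ⟨_, ha a⟩)
  exact (h.isGaussianProcess_φ.hasGaussianLaw I).map_fun L

end SMLCRun.IsMFGP

/-! ### Posterior mean and variance -/

namespace SMLCRun.IsMFGP

variable {D : Set Plane} {s N n₀ : ℕ} {Ω : Type*} [MeasurableSpace Ω] {P : Measure Ω}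
  [IsProbabilityMeasure P] {R : SMLCRun D s N n₀ Ω} {M : MFModel D s}
  {ι : Type} [Fintype ι] [DecidableEq ι]

omit [DecidableEq ι] in
lemma sum_priorCov_nonneg (h : R.IsMFGP M P) (lev : ι → Fin (s + 1)) (loc : ι → D) (w : ι → ℝ) :
    0 ≤ ∑ a, ∑ b, w a * w b * M.priorCov (lev a) (lev b) (loc a) (loc b) := by
  have hL2 : ∀ a, MemLp (fun ω => w a * R.φ (lev a) (loc a) ω) 2 P := fun a =>
    (h.isGaussianProcess_φ.hasGaussianLaw_eval (lev a, loc a)).memLp_two.const_mul _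
  have hm : Measurable fun ω => ∑ a, w a * R.φ (lev a) (loc a) ω :=
    Finset.measurable_sum _ fun a _ => (h.measurable_φ _ _).const_mul _
  have := variance_nonneg (fun ω => ∑ a, w a * R.φ (lev a) (loc a) ω) P
  rw [← covariance_self hm.aemeasurable, covariance_fun_sum_fun_sum hL2 hL2] at this
  simp_rw [covariance_const_mul_left, covariance_const_mul_right, h.covariance_φ] at this
  simpa only [mul_assoc] using this

omit [IsProbabilityMeasure P] [Fintype ι] in
lemma gram_transpose (h : R.IsMFGP M P) (lev : ι → Fin (s + 1)) (loc : ι → D) :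
    (M.gram lev loc)ᵀ = M.gram lev loc := by
  rw [MFModel.gram, Matrix.transpose_add, Matrix.diagonal_transpose]
  congr 1
  ext a b
  exact h.priorCov_comm _ _ _ _

lemma _root_.MFModel.gram_mulVec (M : MFModel D s) (lev : ι → Fin (s + 1))
    (loc : ι → D) (w : ι → ℝ) (a : ι) :
    (M.gram lev loc *ᵥ w) a =
      ∑ b, M.priorCov (lev a) (lev b) (loc a) (loc b) * w b + M.σ (lev a) ^ 2 * w a := by
  rw [MFModel.gram, Matrix.add_mulVec, Pi.add_apply, Matrix.mulVec_diagonal]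
  rfl

lemma _root_.MFModel.dotProduct_gram_mulVec (M : MFModel D s) (lev : ι → Fin (s + 1))
    (loc : ι → D) (w : ι → ℝ) :
    w ⬝ᵥ (M.gram lev loc *ᵥ w) =
      ∑ a, ∑ b, w a * w b * M.priorCov (lev a) (lev b) (loc a) (loc b) +
        ∑ a, M.σ (lev a) ^ 2 * w a ^ 2 := by
  simp_rw [dotProduct, M.gram_mulVec, mul_add, Finset.sum_add_distrib, Finset.mul_sum]
  congr 1
  · refine Finset.sum_congr rfl fun a _ => Finset.sum_congr rfl fun b _ => by ring
  · refine Finset.sum_congr rfl fun a _ => by ring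

lemma gram_posDef (h : R.IsMFGP M P) (lev : ι → Fin (s + 1)) (loc : ι → D) :
    (M.gram lev loc).PosDef := by
  refine Matrix.PosDef.of_dotProduct_mulVec_pos ?_ fun w hw => ?_
  · rw [Matrix.IsHermitian, Matrix.conjTranspose_eq_transpose_of_trivial, h.gram_transpose]
  · rw [star_trivial, M.dotProduct_gram_mulVec]
    obtain ⟨a, ha⟩ : ∃ a, w a ≠ 0 := by
      by_contra! hc; exact hw (funext hc)
    have h2 : 0 < ∑ a, M.σ (lev a) ^ 2 * w a ^ 2 := by
      refine Finset.sum_pos' (fun a _ => by positivity) ⟨a, Finset.mem_univ a, ?_⟩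
      have := M.σ_pos (lev a)
      positivity
    linarith [h.sum_priorCov_nonneg lev loc w]

lemma gram_det_ne_zero (h : R.IsMFGP M P) (lev : ι → Fin (s + 1)) (loc : ι → D) :
    (M.gram lev loc).det ≠ 0 := (h.gram_posDef lev loc).det_pos.ne'

lemma gram_mulVec_inv (h : R.IsMFGP M P) (lev : ι → Fin (s + 1)) (loc : ι → D) (k : ι → ℝ) :
    M.gram lev loc *ᵥ ((M.gram lev loc)⁻¹ *ᵥ k) = k := by
  rw [Matrix.mulVec_mulVec, Matrix.mul_nonsing_inv _ (h.gram_det_ne_zero lev loc).isUnit,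
    Matrix.one_mulVec]

omit [IsProbabilityMeasure P] in
lemma dotProduct_gram_comm (h : R.IsMFGP M P) (lev : ι → Fin (s + 1)) (loc : ι → D)
    (u w : ι → ℝ) : u ⬝ᵥ (M.gram lev loc *ᵥ w) = w ⬝ᵥ (M.gram lev loc *ᵥ u) := by
  rw [Matrix.dotProduct_mulVec, ← Matrix.mulVec_transpose, h.gram_transpose, dotProduct_comm]

omit [IsProbabilityMeasure P] in
lemma dotProduct_gram_inv_comm (h : R.IsMFGP M P) (lev : ι → Fin (s + 1)) (loc : ι → D)
    (u w : ι → ℝ) : u ⬝ᵥ ((M.gram lev loc)⁻¹ *ᵥ w) = w ⬝ᵥ ((M.gram lev loc)⁻¹ *ᵥ u) := by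
  rw [Matrix.dotProduct_mulVec, ← Matrix.mulVec_transpose, Matrix.transpose_nonsing_inv,
    h.gram_transpose, dotProduct_comm]

lemma postCov_add_sq_error (h : R.IsMFGP M P) (lev : ι → Fin (s + 1)) (loc : ι → D) (x : D)
    (w : ι → ℝ) :
    M.priorCov (Fin.last s) (Fin.last s) x x - 2 * (w ⬝ᵥ M.crossCov lev loc x) +
        w ⬝ᵥ (M.gram lev loc *ᵥ w) = M.postCov lev loc x x +
      (w - (M.gram lev loc)⁻¹ *ᵥ M.crossCov lev loc x) ⬝ᵥ (M.gram lev loc *ᵥ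
        (w - (M.gram lev loc)⁻¹ *ᵥ M.crossCov lev loc x)) := by
  set k := M.crossCov lev loc x
  set u := (M.gram lev loc)⁻¹ *ᵥ k with hu
  have h1 : M.gram lev loc *ᵥ u = k := h.gram_mulVec_inv lev loc k
  rw [MFModel.postCov, Matrix.mulVec_sub, dotProduct_sub, sub_dotProduct, sub_dotProduct,
    h.dotProduct_gram_comm lev loc u w, h1, dotProduct_comm u k]
  ring

/-- The posterior variance is the least mean square error of a linear estimate. -/
lemma postCov_le (h : R.IsMFGP M P) (lev : ι → Fin (s + 1)) (loc : ι → D) (x : D) (w : ι → ℝ) :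
    M.postCov lev loc x x ≤ M.priorCov (Fin.last s) (Fin.last s) x x -
      2 * (w ⬝ᵥ M.crossCov lev loc x) + w ⬝ᵥ (M.gram lev loc *ᵥ w) := by
  rw [h.postCov_add_sq_error]
  have := (h.gram_posDef lev loc).posSemidef.dotProduct_mulVec_nonneg
    (w - (M.gram lev loc)⁻¹ *ᵥ M.crossCov lev loc x)
  rw [star_trivial] at this
  linarith

/-- Additional measurements do not increase the posterior variance. -/
lemma postCov_sumElim_le (h : R.IsMFGP M P) {ι₁ ι₂ : Type} [Fintype ι₁] [DecidableEq ι₁]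
    [Fintype ι₂] [DecidableEq ι₂] [IsEmpty ι₂] (lev : ι → Fin (s + 1)) (loc : ι → D)
    (lev₁ : ι₁ → Fin (s + 1)) (loc₁ : ι₁ → D) (lev₂ : ι₂ → Fin (s + 1)) (loc₂ : ι₂ → D) (x : D) :
    M.postCov (Sum.elim lev lev₁) (Sum.elim loc loc₁) x x ≤
      M.postCov (Sum.elim lev lev₂) (Sum.elim loc loc₂) x x := by
  set u := (M.gram (Sum.elim lev lev₂) (Sum.elim loc loc₂))⁻¹ *ᵥ
    M.crossCov (Sum.elim lev lev₂) (Sum.elim loc loc₂) x with hu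
  have h1 := h.postCov_add_sq_error (Sum.elim lev lev₂) (Sum.elim loc loc₂) x u
  rw [← hu, sub_self, zero_dotProduct, add_zero] at h1
  rw [← h1]
  refine (h.postCov_le _ _ x (Sum.elim (fun a => u (Sum.inl a)) 0)).trans_eq ?_
  rw [M.dotProduct_gram_mulVec, M.dotProduct_gram_mulVec]
  simp [dotProduct, Fintype.sum_sum_type, MFModel.crossCov]

/-- If there are measurements near `x`, then the variance is at most that of their average. -/
lemma postCov_le_of_near (h : R.IsMFGP M P) (lev : ι → Fin (s + 1)) (loc : ι → D) (x : D)
    (T : Finset ι) (hT : T.Nonempty) (hlev : ∀ a ∈ T, lev a = Fin.last s) {η : ℝ}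
    (hη : ∀ a ∈ T, ∀ b ∈ T, M.priorCov (Fin.last s) (Fin.last s) x x
      - M.priorCov (Fin.last s) (Fin.last s) (loc a) x
      - M.priorCov (Fin.last s) (Fin.last s) (loc b) x
      + M.priorCov (Fin.last s) (Fin.last s) (loc a) (loc b) ≤ η) :
    M.postCov lev loc x x ≤ η + M.σ (Fin.last s) ^ 2 / T.card := by
  have hc : (0 : ℝ) < T.card := by exact_mod_cast hT.card_pos
  set κ := M.priorCov (Fin.last s) (Fin.last s) with hκ
  set r : ℝ := (T.card : ℝ)⁻¹ with hr
  have hrc : r * T.card = 1 := inv_mul_cancel₀ hc.ne'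
  have hr0 : 0 < r := inv_pos.2 hc
  let w : ι → ℝ := fun a => if a ∈ T then r else 0
  refine (h.postCov_le lev loc x w).trans ?_
  rw [M.dotProduct_gram_mulVec]
  have e1 : w ⬝ᵥ M.crossCov lev loc x = ∑ a ∈ T, r * κ (loc a) x := by
    rw [dotProduct, ← Finset.sum_subset (Finset.subset_univ T)]
    · exact Finset.sum_congr rfl fun a ha => by simp [w, ha, MFModel.crossCov, hlev a ha, hκ]
    · intro a _ ha; simp [w, ha]
  have e2 : ∑ a, ∑ b, w a * w b * M.priorCov (lev a) (lev b) (loc a) (loc b) =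
      ∑ a ∈ T, ∑ b ∈ T, r * r * κ (loc a) (loc b) := by
    rw [← Finset.sum_subset (Finset.subset_univ T)]
    · refine Finset.sum_congr rfl fun a ha => ?_
      rw [← Finset.sum_subset (Finset.subset_univ T)]
      · exact Finset.sum_congr rfl fun b hb => by simp [w, ha, hb, hlev a ha, hlev b hb, hκ]
      · intro b _ hb; simp [w, hb]
    · intro a _ ha; simp [w, ha]
  have e3 : ∑ a, M.σ (lev a) ^ 2 * w a ^ 2 = M.σ (Fin.last s) ^ 2 / T.card := by
    rw [← Finset.sum_subset (Finset.subset_univ T)]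
    · have : ∀ a ∈ T, M.σ (lev a) ^ 2 * w a ^ 2 = M.σ (Fin.last s) ^ 2 * r ^ 2 := by
        intro a ha; simp [w, ha, hlev a ha]
      rw [Finset.sum_congr rfl this, Finset.sum_const, nsmul_eq_mul]
      rw [hr]; field_simp
    · intro a _ ha; simp [w, ha]
  rw [e1, e2, e3, ← add_assoc]
  gcongr
  -- the weights sum to one, so the prior terms are an average over pairs
  have e4 : κ x x - 2 * ∑ a ∈ T, r * κ (loc a) x +
      ∑ a ∈ T, ∑ b ∈ T, r * r * κ (loc a) (loc b) =
      ∑ a ∈ T, ∑ b ∈ T, r * r * (κ x x - κ (loc a) x - κ (loc b) x + κ (loc a) (loc b)) := by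
    simp_rw [mul_add, mul_sub, Finset.sum_add_distrib, Finset.sum_sub_distrib, Finset.sum_const,
      nsmul_eq_mul, ← Finset.mul_sum]
    linear_combination (-(κ x x) * (r * T.card + 1) + 2 * r * ∑ a ∈ T, κ (loc a) x) * hrc
  rw [e4]
  calc _ ≤ ∑ a ∈ T, ∑ b ∈ T, r * r * η := by
        refine Finset.sum_le_sum fun a ha => Finset.sum_le_sum fun b hb => ?_
        exact mul_le_mul_of_nonneg_left (hη a ha b hb) (by positivity)
    _ = η := by
        simp only [Finset.sum_const, nsmul_eq_mul]
        linear_combination η * (r * T.card + 1) * hrc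

lemma continuous_gram_inv (h : R.IsMFGP M P) (lev : ι → Fin (s + 1)) :
    Continuous fun loc : ι → D => (M.gram lev loc)⁻¹ := by
  have hg : Continuous fun loc : ι → D => M.gram lev loc := by
    refine Continuous.add (continuous_matrix fun a b => ?_) continuous_const
    exact (M.continuous_priorCov (lev a) (lev b)).comp
      (by fun_prop : Continuous fun loc : ι → D => (loc a, loc b))
  simp_rw [Matrix.inv_def, Ring.inverse_eq_inv']
  exact (hg.matrix_det.inv₀ fun loc => h.gram_det_ne_zero lev loc).smul hg.matrix_adjugate

omit [Fintype ι] [DecidableEq ι] in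
lemma _root_.MFModel.continuous_crossCov (M : MFModel D s) (lev : ι → Fin (s + 1)) :
    Continuous fun p : (ι → D) × D => M.crossCov lev p.1 p.2 := by
  refine continuous_pi fun a => ?_
  exact (M.continuous_priorCov (lev a) (Fin.last s)).comp
    (by fun_prop : Continuous fun p : (ι → D) × D => (p.1 a, p.2))

lemma continuous_postMean (h : R.IsMFGP M P) (lev : ι → Fin (s + 1)) :
    Continuous fun p : ((ι → D) × (ι → ℝ)) × D => M.postMean lev p.1.1 p.1.2 p.2 := by
  unfold MFModel.postMean
  refine ((M.continuous_priorMean _).comp continuous_snd).add (Continuous.dotProduct ?_ ?_)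
  · exact (M.continuous_crossCov lev).comp (by fun_prop : Continuous fun
      p : ((ι → D) × (ι → ℝ)) × D => (p.1.1, p.2))
  · refine Continuous.matrix_mulVec ((h.continuous_gram_inv lev).comp (by fun_prop)) ?_
    refine continuous_pi fun a => Continuous.sub (by fun_prop) ?_
    exact (M.continuous_priorMean (lev a)).comp (by fun_prop)

lemma continuous_postCov (h : R.IsMFGP M P) (lev : ι → Fin (s + 1)) :
    Continuous fun p : (ι → D) × D => M.postCov lev p.1 p.2 p.2 := by
  unfold MFModel.postCov
  refine ((M.continuous_priorCov _ _).comp (by fun_prop : Continuous fun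
      p : (ι → D) × D => (p.2, p.2))).sub (Continuous.dotProduct ?_ ?_)
  · exact M.continuous_crossCov lev
  · exact Continuous.matrix_mulVec ((h.continuous_gram_inv lev).comp continuous_fst)
      (M.continuous_crossCov lev)

/-- For a fixed design and fixed values of the measurements, the field reweighted by the likelihood
is Gaussian with the posterior mean; its variance at a point is the posterior variance. -/
lemma posterior (h : R.IsMFGP M P) (lev : ι → Fin (s + 1)) (loc : ι → D) (y : ι → ℝ) (x x' : D)
    (c : ℝ) : ∃ v : ℝ≥0, (c = 0 → (v : ℝ) = M.postCov lev loc x x) ∧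
    ∀ E, MeasurableSet E →
      ∫⁻ ω in (fun ω => R.φ (Fin.last s) x ω - c * R.φ (Fin.last s) x' ω) ⁻¹' E,
        lik (fun a => M.σ (lev a)) y (fun a => R.φ (lev a) (loc a) ω) ∂P =
      (∫⁻ ω, lik (fun a => M.σ (lev a)) y (fun a => R.φ (lev a) (loc a) ω) ∂P) *
        gaussianReal (M.postMean lev loc y x - c * M.postMean lev loc y x') v E := by
  have hG := h.hasGaussianLaw_sub_mul lev loc (Fin.last s) x x' c
  have hφ2 : ∀ f x, MemLp (R.φ f x) 2 P := fun f x =>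
    (h.isGaussianProcess_φ.hasGaussianLaw_eval (f, x)).memLp_two
  have hφ1 : ∀ f x, Integrable (R.φ f x) P := fun f x =>
    (h.isGaussianProcess_φ.hasGaussianLaw_eval (f, x)).integrable
  set k : ι → ℝ := M.crossCov lev loc x - c • M.crossCov lev loc x' with hk
  set w := (M.gram lev loc)⁻¹ *ᵥ k with hw
  have hcov : ∀ a, cov[R.φ (lev a) (loc a),
      fun ω => R.φ (Fin.last s) x ω - c * R.φ (Fin.last s) x' ω; P] = k a := by
    intro a
    rw [covariance_fun_sub_right (hφ2 _ _) (hφ2 _ _) ((hφ2 _ _).const_mul _),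
      covariance_const_mul_right, h.covariance_φ, h.covariance_φ]
    rfl
  have hnormal : ∀ a, ∑ b, cov[R.φ (lev a) (loc a), R.φ (lev b) (loc b); P] * w b +
      M.σ (lev a) ^ 2 * w a = cov[R.φ (lev a) (loc a),
      fun ω => R.φ (Fin.last s) x ω - c * R.φ (Fin.last s) x' ω; P] := by
    intro a
    simp_rw [h.covariance_φ]
    rw [hcov, ← M.gram_mulVec, hw, h.gram_mulVec_inv]
  obtain ⟨h0, hlaw⟩ := HasGaussianLaw.posterior hG
    ((h.measurable_φ _ _).sub ((h.measurable_φ _ _).const_mul _))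
    (fun a => h.measurable_φ _ _) (fun a => M.σ_pos (lev a)) y w hnormal
  have hmean : ∫ ω, (R.φ (Fin.last s) x ω - c * R.φ (Fin.last s) x' ω) ∂P +
      ∑ a, w a * (y a - ∫ ω, R.φ (lev a) (loc a) ω ∂P) =
      M.postMean lev loc y x - c * M.postMean lev loc y x' := by
    rw [integral_sub (hφ1 _ _) ((hφ1 _ _).const_mul _), integral_const_mul]
    simp_rw [h.integral_φ]
    have : ∑ a, w a * (y a - M.priorMean (lev a) (loc a)) =
        k ⬝ᵥ ((M.gram lev loc)⁻¹ *ᵥ fun a => y a - M.priorMean (lev a) (loc a)) := by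
      rw [h.dotProduct_gram_inv_comm, dotProduct_comm]
      rfl
    rw [this, hk, sub_dotProduct, smul_dotProduct, MFModel.postMean, MFModel.postMean, smul_eq_mul]
    ring
  rw [hmean] at hlaw
  refine ⟨_, ?_, hlaw⟩
  rintro rfl
  rw [Real.coe_toNNReal _ h0]
  simp_rw [hcov]
  simp only [zero_mul, sub_zero]
  rw [← covariance_self (h.measurable_φ _ _).aemeasurable, h.covariance_φ, MFModel.postCov]
  congr 1
  have hk0 : k = M.crossCov lev loc x := by simp [hk]
  rw [hw, hk0, dotProduct_comm]
  rfl

end SMLCRun.IsMFGP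

/-! ### Regularity and measurability of a run -/

/-- The properties of posterior means and variances of an `MFModel` whose `cov` are covariance
functions. They do not mention the sample space, so that they can be used together with any
σ-algebra on it. -/
structure MFModel.WellPosed {D : Set Plane} {s : ℕ} (M : MFModel D s) : Prop where
  continuous_postMean : ∀ {ι : Type} [Fintype ι] [DecidableEq ι] (lev : ι → Fin (s + 1)),
    Continuous fun p : ((ι → D) × (ι → ℝ)) × D => M.postMean lev p.1.1 p.1.2 p.2
  continuous_postCov : ∀ {ι : Type} [Fintype ι] [DecidableEq ι] (lev : ι → Fin (s + 1)),
    Continuous fun p : (ι → D) × D => M.postCov lev p.1 p.2 p.2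
  postCov_nonneg : ∀ {ι : Type} [Fintype ι] [DecidableEq ι] (lev : ι → Fin (s + 1)) (loc : ι → D)
    (x : D), 0 ≤ M.postCov lev loc x x
  postCov_sumElim_le : ∀ {ι ι₁ ι₂ : Type} [Fintype ι] [DecidableEq ι] [Fintype ι₁]
    [DecidableEq ι₁] [Fintype ι₂] [DecidableEq ι₂] [IsEmpty ι₂] (lev : ι → Fin (s + 1))
    (loc : ι → D) (lev₁ : ι₁ → Fin (s + 1)) (loc₁ : ι₁ → D) (lev₂ : ι₂ → Fin (s + 1))
    (loc₂ : ι₂ → D) (x : D),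
    M.postCov (Sum.elim lev lev₁) (Sum.elim loc loc₁) x x ≤
      M.postCov (Sum.elim lev lev₂) (Sum.elim loc loc₂) x x

lemma SMLCRun.IsMFGP.wellPosed {D : Set Plane} {s N n₀ : ℕ} {Ω : Type*} [MeasurableSpace Ω]
    {P : Measure Ω} [IsProbabilityMeasure P] {R : SMLCRun D s N n₀ Ω} {M : MFModel D s}
    (h : R.IsMFGP M P) : M.WellPosed where
  continuous_postMean lev := h.continuous_postMean lev
  continuous_postCov lev := h.continuous_postCov lev
  postCov_nonneg lev loc x := by
    obtain ⟨v, hv, -⟩ := h.posterior lev loc 0 x x 0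
    rw [← hv rfl]
    exact v.2
  postCov_sumElim_le lev loc lev₁ loc₁ lev₂ loc₂ x :=
    h.postCov_sumElim_le lev loc lev₁ loc₁ lev₂ loc₂ x

lemma isFiniteMeasure_area {D : Set Plane} (hD : IsCompact D) : IsFiniteMeasure (area D) := by
  refine ⟨?_⟩
  rw [area, (MeasurableEmbedding.subtype_coe hD.measurableSet).comap_apply, Set.image_univ,
    Subtype.range_coe]
  exact hD.measure_lt_top

namespace SMLCRun

variable {D : Set Plane} {s N n₀ : ℕ} {Ω : Type*} (R : SMLCRun D s N n₀ Ω) {M : MFModel D s}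

/-- The value reported by agent `i` in iteration `t`, `0` if it does not measure. -/
def yObs (t : ℕ) (i : Fin N) (ω : Ω) : ℝ := if R.b t i ω = true then R.y t i ω else 0

variable (M) in
/-- The estimate as a function of the pattern `β` of learning steps and of the data. -/
def estOf (t : ℕ) (β : Fin t × Fin N → Bool)
    (d : ((Fin t × Fin N → D) × (Fin n₀ → ℝ) × (Fin t × Fin N → ℝ)) × D) : ℝ :=
  M.postMean (ι := Fin n₀ ⊕ {p : Fin t × Fin N // β p = true})
    (Sum.elim R.lev₀ fun _ => Fin.last s) (Sum.elim R.loc₀ fun p => d.1.1 p.1)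
    (Sum.elim d.1.2.1 fun p => d.1.2.2 p.1) d.2

variable (M) in
/-- The posterior variance as a function of the pattern `β` of learning steps and of the sampling
points. -/
def varOf (t : ℕ) (β : Fin t × Fin N → Bool) (d : (Fin t × Fin N → D) × D) : ℝ :=
  M.postCov (ι := Fin n₀ ⊕ {p : Fin t × Fin N // β p = true})
    (Sum.elim R.lev₀ fun _ => Fin.last s) (Sum.elim R.loc₀ fun p => d.1 p.1) d.2 d.2

lemma est_eq_estOf (t : ℕ) (ω : Ω) (x : D) : R.est M t ω x =
    R.estOf M t (fun p => R.b p.1 p.2 ω) ((fun p => R.xmax p.1 p.2 ω, fun j => R.y₀ j ω,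
      fun p => R.yObs p.1 p.2 ω), x) := by
  have : R.obsVal t ω = Sum.elim (fun j => R.y₀ j ω)
      (fun p : {p : Fin t × Fin N // R.b p.1 p.2 ω = true} => R.yObs p.1.1 p.1.2 ω) := by
    funext a
    rcases a with j | ⟨p, hp⟩
    · rfl
    · simp [obsVal, yObs, hp]
  rw [est, this]
  rfl

lemma var_eq_varOf (t : ℕ) (ω : Ω) (x : D) : R.var M t ω x =
    R.varOf M t (fun p => R.b p.1 p.2 ω) (fun p => R.xmax p.1 p.2 ω, x) := rfl

lemma continuous_estOf (hM : M.WellPosed) (t : ℕ) (β : Fin t × Fin N → Bool) :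
    Continuous (R.estOf M t β) := by
  refine (hM.continuous_postMean (ι := Fin n₀ ⊕ {p : Fin t × Fin N // β p = true}) _).comp
    (Continuous.prodMk (Continuous.prodMk (continuous_pi fun a => ?_) (continuous_pi fun a => ?_))
      continuous_snd)
  · rcases a with j | p
    · exact continuous_const
    · exact (continuous_apply p.1).comp (continuous_fst.comp continuous_fst)
  · rcases a with j | p
    · exact (continuous_apply j).comp (continuous_fst.comp (continuous_snd.comp continuous_fst))
    · exact (continuous_apply p.1).comp
        (continuous_snd.comp (continuous_snd.comp continuous_fst))

lemma continuous_varOf (hM : M.WellPosed) (t : ℕ) (β : Fin t × Fin N → Bool) :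
    Continuous (R.varOf M t β) := by
  refine (hM.continuous_postCov (ι := Fin n₀ ⊕ {p : Fin t × Fin N // β p = true}) _).comp
    (Continuous.prodMk (continuous_pi fun a => ?_) continuous_snd)
  rcases a with j | p
  · exact continuous_const
  · exact (continuous_apply p.1).comp continuous_fst

lemma continuous_var (hM : M.WellPosed) (t : ℕ) (ω : Ω) : Continuous (R.var M t ω) :=
  (R.continuous_varOf hM t fun p => R.b p.1 p.2 ω).comp
    (by fun_prop : Continuous fun x : D => ((fun p : Fin t × Fin N => R.xmax p.1 p.2 ω), x))

lemma var_nonneg (hM : M.WellPosed) (t : ℕ) (ω : Ω) (x : D) : 0 ≤ R.var M t ω x :=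
  hM.postCov_nonneg _ _ x

lemma var_le_var_zero (hM : M.WellPosed) (t : ℕ) (ω ω' : Ω) (x : D) :
    R.var M t ω x ≤ R.var M 0 ω' x := by
  have : IsEmpty {p : Fin 0 × Fin N // R.b p.1 p.2 ω' = true} := ⟨fun p => p.1.1.elim0⟩
  exact hM.postCov_sumElim_le R.lev₀ R.loc₀ _ _ _ _ x

lemma var_zero_eq (hM : M.WellPosed) (ω ω' : Ω) : R.var M 0 ω = R.var M 0 ω' :=
  funext fun x => le_antisymm (R.var_le_var_zero hM 0 ω ω' x) (R.var_le_var_zero hM 0 ω' ω x)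

lemma maxVar_zero_eq (hM : M.WellPosed) (ω ω' : Ω) : R.maxVar M 0 ω = R.maxVar M 0 ω' := by
  rw [maxVar, maxVar, R.var_zero_eq hM ω ω']

lemma var_le_maxVar_zero (hD : IsCompact D) (hM : M.WellPosed) (t : ℕ) (ω ω' : Ω) (x : D) :
    R.var M t ω x ≤ R.maxVar M 0 ω' := by
  have := isCompact_iff_compactSpace.1 hD
  exact (R.var_le_var_zero hM t ω ω' x).trans
    (le_csSup (isCompact_range (R.continuous_var hM 0 ω')).bddAbove ⟨x, rfl⟩)

lemma var_div_mem_Icc (hD : IsCompact D) (hM : M.WellPosed) (t : ℕ) (ω ω' : Ω) (x : D) :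
    R.var M t ω x / R.maxVar M 0 ω' ∈ Set.Icc (0 : ℝ) 1 := by
  have h1 := R.var_nonneg hM t ω x
  have h2 := R.var_le_maxVar_zero hD hM t ω ω' x
  exact ⟨div_nonneg h1 (h1.trans h2), div_le_one_of_le₀ h2 (h1.trans h2)⟩

lemma exists_mem_cell (hN : 0 < N) (t : ℕ) (ω : Ω) (x : D) : ∃ i, x ∈ R.cell t i ω := by
  have : Nonempty (Fin N) := ⟨⟨0, hN⟩⟩
  obtain ⟨i, hi⟩ := Finite.exists_min fun i => ‖(x : Plane) - R.gen t i ω‖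
  exact ⟨i, hi⟩

lemma maxVarCell_eq {F : ℝ → ℝ} (halg : R.IsSMLC M F) {t : ℕ} {i : Fin N} {ω : Ω}
    (hne : (R.cell t i ω).Nonempty) : R.maxVarCell M t i ω = R.var M t ω (R.xmax t i ω) := by
  have hmax : IsGreatest (R.var M t ω '' R.cell t i ω) (R.var M t ω (R.xmax t i ω)) := by
    refine ⟨⟨_, halg.xmax_mem t i ω hne, rfl⟩, ?_⟩
    rintro _ ⟨x, hx, rfl⟩
    exact halg.xmax_max t i ω hx
  exact hmax.csSup_eq

lemma learn_iff {F : ℝ → ℝ} (halg : R.IsSMLC M F) (hD : IsCompact D) (hM : M.WellPosed) (t : ℕ)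
    (i : Fin N) (ω : Ω) : R.b t i ω = true ↔ (R.cell t i ω).Nonempty ∧
      R.coin t i ω < Set.IccExtend zero_le_one (Set.domRestrict (Set.Icc 0 1) F)
        (R.var M t ω (R.xmax t i ω) / R.maxVar M 0 ω) := by
  rw [halg.learn]
  refine and_congr_right fun hne => ?_
  rw [R.maxVarCell_eq halg hne,
    Set.IccExtend_of_mem _ _ (R.var_div_mem_Icc hD hM t ω ω (R.xmax t i ω))]
  rfl

section Measurable

variable [MeasurableSpace Ω] {t : ℕ}

lemma measurable_est (hM : M.WellPosed) (hy₀ : ∀ j, Measurable (R.y₀ j))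
    (hb : ∀ p : Fin t × Fin N, Measurable (R.b p.1 p.2))
    (hx : ∀ p : Fin t × Fin N, Measurable (R.xmax p.1 p.2))
    (hy : ∀ p : Fin t × Fin N, Measurable (R.yObs p.1 p.2)) :
    Measurable fun p : Ω × D => R.est M t p.1 p.2 := by
  simp_rw [R.est_eq_estOf]
  have h1 : Measurable fun q : (Fin t × Fin N → Bool) × _ => R.estOf M t q.1 q.2 :=
    measurable_from_prod_countable_right fun β => (R.continuous_estOf hM t β).measurable
  refine h1.comp (Measurable.prodMk (measurable_pi_lambda _ fun p => (hb p).comp measurable_fst)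
    (Measurable.prodMk (Measurable.prodMk ?_ (Measurable.prodMk ?_ ?_)) measurable_snd))
  · exact measurable_pi_lambda _ fun p => (hx p).comp measurable_fst
  · exact measurable_pi_lambda _ fun j => (hy₀ j).comp measurable_fst
  · exact measurable_pi_lambda _ fun p => (hy p).comp measurable_fst

lemma measurable_var (hM : M.WellPosed)
    (hb : ∀ p : Fin t × Fin N, Measurable (R.b p.1 p.2))
    (hx : ∀ p : Fin t × Fin N, Measurable (R.xmax p.1 p.2)) :
    Measurable fun p : Ω × D => R.var M t p.1 p.2 := by
  have h1 : Measurable fun q : (Fin t × Fin N → Bool) × _ => R.varOf M t q.1 q.2 :=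
    measurable_from_prod_countable_right fun β => (R.continuous_varOf hM t β).measurable
  simp_rw [R.var_eq_varOf]
  refine h1.comp (Measurable.prodMk (measurable_pi_lambda _ fun p => (hb p).comp measurable_fst)
    (Measurable.prodMk ?_ measurable_snd))
  exact measurable_pi_lambda _ fun p => (hx p).comp measurable_fst

lemma measurableSet_cell (hg : ∀ i, Measurable (R.gen t i)) (i : Fin N) :
    MeasurableSet {p : Ω × D | p.2 ∈ R.cell t i p.1} := by
  have hcell : {p : Ω × D | p.2 ∈ R.cell t i p.1} =
      ⋂ j, {p | ‖(p.2 : Plane) - R.gen t i p.1‖ ≤ ‖(p.2 : Plane) - R.gen t j p.1‖} := by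
    ext p
    simp only [Set.mem_iInter]
    rfl
  rw [hcell]
  have hn : ∀ j, Measurable fun p : Ω × D => ‖(p.2 : Plane) - R.gen t j p.1‖ := fun j =>
    ((measurable_subtype_coe.comp measurable_snd).sub ((hg j).comp measurable_fst)).norm
  exact MeasurableSet.iInter fun j => measurableSet_le (hn i) (hn j)

lemma measurableSet_cell_nonempty (hD : IsCompact D) (hg : ∀ i, Measurable (R.gen t i))
    (i : Fin N) : MeasurableSet {ω | (R.cell t i ω).Nonempty} := by
  have := isCompact_iff_compactSpace.1 hD
  let C : Set (D × (Fin N → Plane)) := {p | ∀ j, ‖(p.1 : Plane) - p.2 i‖ ≤ ‖(p.1 : Plane) - p.2 j‖}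
  have hC : IsClosed C := by
    simp only [C, Set.ofPred_forall]
    exact isClosed_iInter fun j => isClosed_le (by fun_prop) (by fun_prop)
  have hC' : IsClosed (Prod.snd '' C) := isClosedMap_snd_of_compactSpace _ hC
  have hgm : Measurable fun ω j => R.gen t j ω := measurable_pi_lambda _ hg
  convert hgm hC'.measurableSet using 1
  ext ω
  simp only [Set.mem_ofPred_eq, Set.mem_preimage, Set.mem_image, Prod.exists, exists_eq_right]
  rfl

lemma measurable_centroid (hD : IsCompact D) (hg : ∀ i, Measurable (R.gen t i))
    (hest : Measurable fun p : Ω × D => R.est M t p.1 p.2) (i : Fin N) :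
    Measurable (R.centroid M t i) := by
  have := isFiniteMeasure_area hD
  have hcell := R.measurableSet_cell hg i
  have hcellω : ∀ ω, MeasurableSet (R.cell t i ω) := fun ω =>
    (measurable_prodMk_left (x := ω)) hcell
  have hmass : Measurable (R.mass M t i) := by
    have h1 : StronglyMeasurable fun p : Ω × D =>
        Set.indicator {p : Ω × D | p.2 ∈ R.cell t i p.1} (fun p => R.est M t p.1 p.2) p :=
      (hest.indicator hcell).stronglyMeasurable
    have h2 := (h1.integral_prod_right' (ν := area D)).measurable
    convert h2 using 1
    funext ω
    rw [mass, ← integral_indicator (hcellω ω)]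
    rfl
  have hmom : Measurable fun ω => ∫ q in R.cell t i ω, R.est M t ω q • (q : Plane) ∂(area D) := by
    have h1 : StronglyMeasurable fun p : Ω × D =>
        Set.indicator {p : Ω × D | p.2 ∈ R.cell t i p.1}
          (fun p => R.est M t p.1 p.2 • (p.2 : Plane)) p :=
      ((hest.smul (measurable_subtype_coe.comp measurable_snd)).indicator hcell).stronglyMeasurable
    have h2 := (h1.integral_prod_right' (ν := area D)).measurable
    convert h2 using 1
    funext ω
    rw [← integral_indicator (hcellω ω)]
    rfl
  unfold centroid
  exact Measurable.ite (hmass (measurableSet_singleton 0)) (hg i) (hmass.inv.smul hmom)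

lemma measurable_b {F : ℝ → ℝ} (hF : ContinuousOn F (Set.Icc 0 1)) (halg : R.IsSMLC M F)
    (hD : IsCompact D) (hM : M.WellPosed) (hg : ∀ i, Measurable (R.gen t i))
    (hvar : Measurable fun p : Ω × D => R.var M t p.1 p.2) {i : Fin N}
    (hx : Measurable (R.xmax t i)) (hcoin : Measurable (R.coin t i)) :
    Measurable (R.b t i) := by
  refine measurable_to_bool ?_
  have hmv : Measurable (R.maxVar M 0) := by
    rcases isEmpty_or_nonempty Ω with hΩ | ⟨⟨ω₀⟩⟩
    · exact measurable_of_empty _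
    · rw [funext fun ω => R.maxVar_zero_eq hM ω ω₀]
      exact measurable_const
  have hcont : Continuous (Set.IccExtend zero_le_one (Set.domRestrict (Set.Icc (0 : ℝ) 1) F)) :=
    (continuousOn_iff_continuous_domRestrict.1 hF).Icc_extend'
  have hset : R.b t i ⁻¹' {true} = {ω | (R.cell t i ω).Nonempty} ∩
      {ω | R.coin t i ω < Set.IccExtend zero_le_one (Set.domRestrict (Set.Icc 0 1) F)
        (R.var M t ω (R.xmax t i ω) / R.maxVar M 0 ω)} := by
    ext ω
    exact R.learn_iff halg hD hM t i ω
  rw [hset]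
  refine (R.measurableSet_cell_nonempty hD hg i).inter (measurableSet_lt hcoin ?_)
  exact hcont.measurable.comp ((hvar.comp (measurable_id.prodMk hx)).div hmv)

end Measurable

/-- If the σ-algebras `𝓢 t` contain the initial data, the random numbers, and the reported values as
soon as the decisions and sampling points are known, then the whole run is adapted to them. -/
structure Adapted (𝓢 : ℕ → MeasurableSpace Ω) : Prop where
  mono : Monotone 𝓢
  y₀ : ∀ j, Measurable[𝓢 0] (R.y₀ j)
  coin : ∀ t i, Measurable[𝓢 (t + 1)] (R.coin t i)
  yObs : ∀ t i, Measurable[𝓢 t] (R.xmax t i) → Measurable[𝓢 (t + 1)] (R.b t i) →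
    Measurable[𝓢 (t + 1)] (R.yObs t i)

lemma history_le {m : MeasurableSpace Ω} {t : ℕ} (hy₀ : ∀ j, Measurable[m] (R.y₀ j))
    (hb : ∀ p : Fin t × Fin N, Measurable[m] (R.b p.1 p.2))
    (hx : ∀ p : Fin t × Fin N, Measurable[m] (R.xmax p.1 p.2))
    (hy : ∀ p : Fin t × Fin N, Measurable[m] (R.yObs p.1 p.2)) : R.history t ≤ m := by
  refine sup_le (iSup_le fun j => (hy₀ j).comap_le) (iSup_le fun p => ?_)
  exact ((hb p).prodMk ((hx p).prodMk (hy p))).comap_le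

variable {R} in
theorem Adapted.measurable {𝓢 : ℕ → MeasurableSpace Ω} (h : R.Adapted 𝓢) {F : ℝ → ℝ}
    (hF : ContinuousOn F (Set.Icc 0 1)) (halg : R.IsSMLC M F) (hD : IsCompact D)
    (hM : M.WellPosed) (t : ℕ) :
    (∀ i, Measurable[𝓢 t] (R.gen t i)) ∧ (∀ i, Measurable[𝓢 t] (R.xmax t i)) ∧
    (∀ p : Fin t × Fin N, Measurable[𝓢 t] (R.b p.1 p.2)) ∧
    (∀ p : Fin t × Fin N, Measurable[𝓢 t] (R.xmax p.1 p.2)) ∧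
    (∀ p : Fin t × Fin N, Measurable[𝓢 t] (R.yObs p.1 p.2)) := by
  have hy₀ : ∀ t j, Measurable[𝓢 t] (R.y₀ j) := fun t j =>
    (h.y₀ j).mono (h.mono (Nat.zero_le t)) le_rfl
  have hxmax : ∀ t, (∀ p : Fin t × Fin N, Measurable[𝓢 t] (R.b p.1 p.2)) →
      (∀ p : Fin t × Fin N, Measurable[𝓢 t] (R.xmax p.1 p.2)) →
      (∀ p : Fin t × Fin N, Measurable[𝓢 t] (R.yObs p.1 p.2)) →
      ∀ i, Measurable[𝓢 t] (R.xmax t i) := fun t hb hx hy i =>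
    (halg.xmax_meas t i).mono (R.history_le (hy₀ t) hb hx hy) le_rfl
  induction t with
  | zero =>
    have hb : ∀ p : Fin 0 × Fin N, Measurable[𝓢 0] (R.b p.1 p.2) := fun p => p.1.elim0
    have hx : ∀ p : Fin 0 × Fin N, Measurable[𝓢 0] (R.xmax p.1 p.2) := fun p => p.1.elim0
    have hy : ∀ p : Fin 0 × Fin N, Measurable[𝓢 0] (R.yObs p.1 p.2) := fun p => p.1.elim0
    refine ⟨fun i => ?_, hxmax 0 hb hx hy, hb, hx, hy⟩
    rw [funext (halg.gen_zero i)]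
    exact measurable_const
  | succ t ih =>
    obtain ⟨hg, hxt, hb, hx, hy⟩ := ih
    have hle : 𝓢 t ≤ 𝓢 (t + 1) := h.mono (Nat.le_succ t)
    have hest := @measurable_est _ _ _ _ _ R _ (𝓢 t) t hM (hy₀ t) hb hx hy
    have hvar := @measurable_var _ _ _ _ _ R _ (𝓢 t) t hM hb hx
    have hvar' : Measurable[(𝓢 (t + 1)).prod inferInstance]
        fun p : Ω × D => R.var M t p.1 p.2 :=
      hvar.mono (sup_le_sup (MeasurableSpace.comap_mono hle) le_rfl) le_rfl
    have hbt : ∀ i, Measurable[𝓢 (t + 1)] (R.b t i) := fun i =>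
      @measurable_b _ _ _ _ _ R _ (𝓢 (t + 1)) t F hF halg hD hM
        (fun j => (hg j).mono hle le_rfl) hvar' i ((hxt i).mono hle le_rfl) (h.coin t i)
    have key : ∀ {β : Type} [MeasurableSpace β] (f : ℕ → Fin N → Ω → β),
        (∀ p : Fin t × Fin N, Measurable[𝓢 t] (f p.1 p.2)) →
        (∀ i, Measurable[𝓢 (t + 1)] (f t i)) →
        ∀ p : Fin (t + 1) × Fin N, Measurable[𝓢 (t + 1)] (f p.1 p.2) := by
      rintro β _ f h1 h2 ⟨t', i⟩
      rcases Nat.lt_succ_iff_lt_or_eq.1 t'.2 with hlt | heq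
      · exact (h1 (⟨t', hlt⟩, i)).mono hle le_rfl
      · simp only [heq]; exact h2 i
    have hb' := key R.b hb hbt
    have hx' := key R.xmax hx fun i => (hxt i).mono hle le_rfl
    have hy' := key R.yObs hy fun i => h.yObs t i (hxt i) (hbt i)
    refine ⟨fun i => ?_, hxmax (t + 1) hb' hx' hy', hb', hx', hy'⟩
    rw [funext (halg.gen_succ t i)]
    exact (@measurable_centroid _ _ _ _ _ R _ (𝓢 t) t hD hg hest i).mono hle le_rfl

end SMLCRun

/-! ### The posterior variance tends to zero -/

namespace SMLCRun

variable {D : Set Plane} {s N n₀ : ℕ} {Ω : Type*}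

/-- The σ-algebra generated by the refinement processes. -/
@[reducible] def fieldSigma (R : SMLCRun D s N n₀ Ω) : MeasurableSpace Ω :=
  ⨆ f, R.sourceSigma (.field f)

/-- The sources of randomness that can influence the decisions before iteration `t`. -/
def sourcesBefore (s N n₀ t : ℕ) : Set (SMLCSource s N n₀) :=
  {a | match a with
    | .field _ => True
    | .noise₀ _ => True
    | .noise t' _ => t' < t
    | .coin t' _ => t' < t}

/-- The σ-algebra of all that can influence the decisions before iteration `t`. -/
@[reducible] def sigmaBefore (R : SMLCRun D s N n₀ Ω) (t : ℕ) : MeasurableSpace Ω :=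
  ⨆ a ∈ sourcesBefore s N n₀ t, R.sourceSigma a

namespace IsMFGP

variable [mΩ : MeasurableSpace Ω] {P : Measure Ω} {R : SMLCRun D s N n₀ Ω} {M : MFModel D s}

lemma sourceSigma_le (h : R.IsMFGP M P) (a : SMLCSource s N n₀) : R.sourceSigma a ≤ mΩ := by
  cases a with
  | field f => exact (measurable_pi_lambda _ fun x => h.field_meas f x).comap_le
  | noise₀ j => exact (h.noise₀_meas j).comap_le
  | noise t i => exact (h.noise_meas t i).comap_le
  | coin t i => exact (h.coin_meas t i).comap_le

lemma fieldSigma_le (h : R.IsMFGP M P) : R.fieldSigma ≤ mΩ :=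
  iSup_le fun f => h.sourceSigma_le (.field f)

lemma measurable_field_φ (h : R.IsMFGP M P) (f : Fin (s + 1)) (x : D) :
    Measurable[R.fieldSigma] (R.φ f x) := by
  rw [funext fun ω => h.φ_eq f x ω]
  refine Finset.measurable_sum _ fun i _ => Measurable.const_mul ?_ _
  have h1 : Measurable[R.sourceSigma (.field i)] (R.δ i x) :=
    (measurable_pi_apply x).comp (comap_measurable fun ω x => R.δ i x ω)
  exact h1.mono (le_iSup (fun f => R.sourceSigma (.field f)) i) le_rfl

omit mΩ in
lemma measurable_eval_of_continuous [MeasurableSpace Ω] {E : Type*} [MeasurableSpace E]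
    {u : D → Ω → ℝ} (hc : ∀ ω, Continuous fun x => u x ω) (hm : ∀ x, Measurable (u x))
    {X : E → D} {T : E → Ω} (hX : Measurable X) (hT : Measurable T) :
    Measurable fun e => u (X e) (T e) :=
  (measurable_uncurry_of_continuous_of_measurable hc hm).comp (hX.prodMk hT)

/-- The field may be evaluated measurably at a random point. -/
lemma measurable_φ_comp (h : R.IsMFGP M P) {E : Type*} {mE : MeasurableSpace E} {T : E → Ω}
    (hT : Measurable[mE, R.fieldSigma] T) (f : Fin (s + 1)) {X : E → D} (hX : Measurable X) :
    Measurable fun e => R.φ f (X e) (T e) :=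
  @measurable_eval_of_continuous D Ω R.fieldSigma E mE (fun x ω => R.φ f x ω)
    (h.continuous_φ f) (h.measurable_field_φ f) X T hX hT

lemma measurable_φ_comp_of_le (h : R.IsMFGP M P) {m : MeasurableSpace Ω} (hm : R.fieldSigma ≤ m)
    (f : Fin (s + 1)) {X : Ω → D} (hX : Measurable[m] X) :
    Measurable[m] fun ω => R.φ f (X ω) ω :=
  h.measurable_φ_comp (mΩ := mΩ) (measurable_id'' hm) f hX

omit mΩ in
lemma _root_.SMLCRun.sourceSigma_le_sigmaBefore (R : SMLCRun D s N n₀ Ω) {a : SMLCSource s N n₀}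
    {t : ℕ} (ha : a ∈ sourcesBefore s N n₀ t) : R.sourceSigma a ≤ R.sigmaBefore t :=
  le_iSup₂_of_le a ha le_rfl

omit mΩ in
lemma _root_.SMLCRun.fieldSigma_le_sigmaBefore (R : SMLCRun D s N n₀ Ω) (t : ℕ) :
    R.fieldSigma ≤ R.sigmaBefore t :=
  iSup_le fun f => R.sourceSigma_le_sigmaBefore (a := .field f) trivial

omit mΩ in
lemma _root_.SMLCRun.sigmaBefore_mono (R : SMLCRun D s N n₀ Ω) : Monotone R.sigmaBefore := by
  intro t t' htt'
  refine biSup_mono fun a ha => ?_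
  cases a with
  | field f => trivial
  | noise₀ j => trivial
  | noise u i => exact lt_of_lt_of_le (show u < t from ha) htt'
  | coin u i => exact lt_of_lt_of_le (show u < t from ha) htt'

lemma adapted_sigmaBefore (h : R.IsMFGP M P) : R.Adapted R.sigmaBefore where
  mono := R.sigmaBefore_mono
  y₀ j := by
    have h1 : Measurable[R.sigmaBefore 0] (R.φ (R.lev₀ j) (R.loc₀ j)) :=
      (h.measurable_field_φ _ _).mono (R.fieldSigma_le_sigmaBefore 0) le_rfl
    have h2 : Measurable[R.sigmaBefore 0] (R.noise₀ j) :=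
      (comap_measurable (R.noise₀ j)).mono
        (R.sourceSigma_le_sigmaBefore (a := .noise₀ j) trivial) le_rfl
    exact h1.add h2
  coin t i := (comap_measurable (R.coin t i)).mono
    (R.sourceSigma_le_sigmaBefore (a := .coin t i) (Nat.lt_succ_self t)) le_rfl
  yObs t i hx hb := by
    have h1 := h.measurable_φ_comp_of_le (R.fieldSigma_le_sigmaBefore (t + 1)) (Fin.last s)
      (hx.mono (R.sigmaBefore_mono (Nat.le_succ t)) le_rfl)
    have h2 : Measurable[R.sigmaBefore (t + 1)] (R.noise t i) :=
      (comap_measurable (R.noise t i)).mono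
        (R.sourceSigma_le_sigmaBefore (a := .noise t i) (Nat.lt_succ_self t)) le_rfl
    exact Measurable.ite (hb (measurableSet_singleton true)) (h1.add h2) measurable_const

lemma exists_near (hD : IsCompact D) (M : MFModel D s) {η : ℝ} (hη : 0 < η) : ∃ r > 0,
    ∀ x a b : D, dist a x < r → dist b x < r →
      M.priorCov (Fin.last s) (Fin.last s) x x - M.priorCov (Fin.last s) (Fin.last s) a x
      - M.priorCov (Fin.last s) (Fin.last s) b x + M.priorCov (Fin.last s) (Fin.last s) a b
        ≤ 3 * η := by
  have := isCompact_iff_compactSpace.1 hD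
  have huc := CompactSpace.uniformContinuous_of_continuous
    (M.continuous_priorCov (Fin.last s) (Fin.last s))
  obtain ⟨r, hr, hr'⟩ := Metric.uniformContinuous_iff.1 huc η hη
  refine ⟨r, hr, fun x a b ha hb => ?_⟩
  have h1 := hr' (a := (a, x)) (b := (x, x)) (by simpa [Prod.dist_eq] using ha)
  have h2 := hr' (a := (b, x)) (b := (x, x)) (by simpa [Prod.dist_eq] using hb)
  have h3 := hr' (a := (a, b)) (b := (x, x)) (by simpa [Prod.dist_eq] using ⟨ha, hb⟩)
  rw [Real.dist_eq, abs_lt] at h1 h2 h3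
  linarith [h1.1, h2.1, h3.2]

/-- Learning steps at points of posterior variance at least `c` take place in a bounded number of
iterations: at such a point there cannot be many earlier samples nearby. -/
lemma exists_card_learning_le (h : R.IsMFGP M P) [IsProbabilityMeasure P] (hD : IsCompact D)
    {c : ℝ} (hc : 0 < c) : ∃ K : ℕ, ∀ ω, ∀ S : Finset ℕ,
      (∀ t ∈ S, ∃ i, R.b t i ω = true ∧ c ≤ R.var M t ω (R.xmax t i ω)) → S.card ≤ K := by
  classical
  have := isCompact_iff_compactSpace.1 hD
  obtain ⟨r, hr, hnear⟩ := exists_near hD M (η := c / 6) (by positivity)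
  obtain ⟨Y, -, hYfin, hY⟩ := Metric.finite_approx_of_totallyBounded
    (isCompact_univ (X := D)).totallyBounded (r / 2) (by positivity)
  obtain ⟨m, hm⟩ := exists_nat_gt (2 * M.σ (Fin.last s) ^ 2 / c)
  have hcover : ∀ x : D, ∃ y ∈ Y, dist x y < r / 2 := by
    intro x
    simpa using hY (Set.mem_univ x)
  choose center hcenter hdist using hcover
  refine ⟨hYfin.toFinset.card * m, fun ω S hS => ?_⟩
  by_contra! hlt
  have hSne : S.Nonempty := Finset.card_pos.1 (by omega)
  obtain ⟨t₀, ht₀⟩ := hSne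
  obtain ⟨i₀, -⟩ := hS t₀ ht₀
  have hS' : ∀ t : ℕ, ∃ i, t ∈ S → R.b t i ω = true ∧ c ≤ R.var M t ω (R.xmax t i ω) := by
    intro t
    by_cases ht : t ∈ S
    · obtain ⟨i, hi⟩ := hS t ht
      exact ⟨i, fun _ => hi⟩
    · exact ⟨i₀, fun h => absurd h ht⟩
  choose a ha using hS'
  let x : ℕ → D := fun t => R.xmax t (a t) ω
  obtain ⟨y, -, hy⟩ := Finset.exists_lt_card_fiber_of_mul_lt_card_of_maps_to
    (f := fun t => center (x t)) (s := S) (t := hYfin.toFinset)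
    (fun t _ => by simpa using hcenter (x t)) hlt
  set S' := S.filter fun t => center (x t) = y with hS'def
  have hS'ne : S'.Nonempty := Finset.card_pos.1 (by omega)
  -- the last of more than `m` samples in one ball has at least `m` predecessors nearby
  set u := S'.max' hS'ne with hu
  have huS' : u ∈ S' := S'.max'_mem hS'ne
  have hltu : ∀ t ∈ S'.erase u, t < u := fun t ht =>
    lt_of_le_of_ne (S'.le_max' _ (Finset.mem_of_mem_erase ht)) (Finset.ne_of_mem_erase ht)
  have hmemS : ∀ t ∈ S'.erase u, t ∈ S := fun t ht =>
    (Finset.mem_filter.1 (Finset.mem_of_mem_erase ht)).1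
  -- the earlier samples in the same ball
  let g : {t // t ∈ S'.erase u} → R.Obs u ω := fun t =>
    Sum.inr ⟨(⟨t.1, hltu t.1 t.2⟩, a t.1), (ha t.1 (hmemS t.1 t.2)).1⟩
  have hg : Function.Injective g := by
    intro t t' htt'
    simp only [g, Sum.inr.injEq, Subtype.mk.injEq, Prod.mk.injEq, Fin.mk.injEq] at htt'
    exact Subtype.ext htt'.1
  let T : Finset (R.Obs u ω) := Finset.univ.image g
  have hTcard : m ≤ T.card := by
    rw [Finset.card_image_of_injective _ hg, Finset.card_univ, Fintype.card_coe,
      Finset.card_erase_of_mem huS']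
    omega
  have hm0 : (0 : ℝ) < m := lt_of_le_of_lt (by positivity) hm
  have hTne : T.Nonempty := Finset.card_pos.1 (lt_of_lt_of_le (by exact_mod_cast hm0) hTcard)
  have hTnear : ∀ o ∈ T, R.obsLev u ω o = Fin.last s ∧ dist (R.obsLoc u ω o) (x u) < r := by
    intro o ho
    obtain ⟨t, -, rfl⟩ := Finset.mem_image.1 ho
    refine ⟨rfl, ?_⟩
    have e1 : center (x t.1) = y := (Finset.mem_filter.1 (Finset.mem_of_mem_erase t.2)).2
    have e2 : center (x u) = y := (Finset.mem_filter.1 huS').2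
    calc dist (x t.1) (x u) ≤ dist (x t.1) y + dist (x u) y := dist_triangle_right _ _ _
      _ < r / 2 + r / 2 := add_lt_add (e1 ▸ hdist (x t.1)) (e2 ▸ hdist (x u))
      _ = r := add_halves r
  have hbound := h.postCov_le_of_near (R.obsLev u ω) (R.obsLoc u ω) (x u) T hTne
    (fun o ho => (hTnear o ho).1) (η := 3 * (c / 6))
    (fun o ho o' ho' => hnear _ _ _ (hTnear o ho).2 (hTnear o' ho').2)
  have hlarge := (ha u (Finset.mem_filter.1 huS').1).2
  have hσ : M.σ (Fin.last s) ^ 2 / T.card < c / 2 := by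
    have hT0 : (0 : ℝ) < T.card := by exact_mod_cast hTne.card_pos
    have h1 : (m : ℝ) ≤ T.card := by exact_mod_cast hTcard
    rw [div_lt_iff₀ hT0]
    rw [div_lt_iff₀ hc] at hm
    nlinarith
  have : R.var M u ω (R.xmax u (a u) ω) ≤ 3 * (c / 6) + M.σ (Fin.last s) ^ 2 / T.card := hbound
  linarith

lemma measure_coin_lt (h : R.IsMFGP M P) {p : ℝ} (hp : p ∈ Set.Icc (0 : ℝ) 1) (t : ℕ) :
    P {ω | ∀ i, R.coin t i ω < p} = ENNReal.ofReal p ^ N := by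
  have hind : iIndepFun (fun i => R.coin t i) P := by
    rw [iIndepFun_iff_iIndep]
    exact h.indep.precomp (g := SMLCSource.coin t) fun a b hab => by simpa using hab
  have hset : {ω | ∀ i, R.coin t i ω < p} = ⋂ i, R.coin t i ⁻¹' Set.Iio p := by
    ext ω; simp
  have hone : ∀ i, P (R.coin t i ⁻¹' Set.Iio p) = ENNReal.ofReal p := by
    intro i
    rw [← Measure.map_apply (h.coin_meas t i) measurableSet_Iio, h.coin_law,
      Measure.restrict_apply measurableSet_Iio]
    have : Set.Iio p ∩ Set.Icc 0 1 = Set.Ico 0 p := by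
      ext x
      simp only [Set.mem_inter_iff, Set.mem_Iio, Set.mem_Icc, Set.mem_Ico]
      have := hp.2
      constructor
      · rintro ⟨h1, h2, h3⟩; exact ⟨h2, h1⟩
      · rintro ⟨h1, h2⟩; exact ⟨h2, h1, by linarith⟩
    rw [this, Real.volume_Ico, sub_zero]
  rw [hset, hind.meas_iInter fun i => ⟨Set.Iio p, measurableSet_Iio, rfl⟩]
  simp [hone]

omit mΩ in
lemma measurableSet_exists_lt_var (hD : IsCompact D) (hM : M.WellPosed) {F : ℝ → ℝ}
    (hF : ContinuousOn F (Set.Icc 0 1)) (halg : R.IsSMLC M F) {𝓢 : ℕ → MeasurableSpace Ω}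
    (h𝓢 : R.Adapted 𝓢) (t : ℕ) (c : ℝ) : MeasurableSet[𝓢 t] {ω | ∃ x, c < R.var M t ω x} := by
  obtain ⟨Y, hYc, hY⟩ := TopologicalSpace.exists_countable_dense D
  obtain ⟨-, -, hb, hx, -⟩ := h𝓢.measurable hF halg hD hM t
  have hvar := @measurable_var _ _ _ _ _ R _ (𝓢 t) t hM hb hx
  have hset : {ω | ∃ x, c < R.var M t ω x} = ⋃ x ∈ Y, {ω | c < R.var M t ω x} := by
    ext ω
    simp only [Set.mem_ofPred_eq, Set.mem_iUnion, exists_prop]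
    constructor
    · rintro ⟨x, hx⟩
      exact hY.exists_mem_open (isOpen_lt continuous_const (R.continuous_var hM t ω)) ⟨x, hx⟩
        |>.imp fun y hy => ⟨hy.1, hy.2⟩
    · rintro ⟨x, -, hx⟩
      exact ⟨x, hx⟩
  rw [hset]
  refine @MeasurableSet.biUnion _ _ (𝓢 t) _ _ hYc fun x _ => ?_
  have hvx : Measurable[𝓢 t] fun ω => R.var M t ω x :=
    @Measurable.comp _ _ _ (𝓢 t) ((𝓢 t).prod inferInstance) _ _ _ hvar
      (@measurable_prodMk_right _ _ (𝓢 t) _ x)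
  exact hvx measurableSet_Ioi

/-- The maximal posterior variance tends to zero in probability. -/
theorem tendsto_measure_lt_var (h : R.IsMFGP M P) [IsProbabilityMeasure P] (hD : IsCompact D)
    (hN : 0 < N) {F : ℝ → ℝ} (hFmaps : Set.MapsTo F (Set.Icc 0 1) (Set.Icc 0 1))
    (hFcont : ContinuousOn F (Set.Icc 0 1)) (hFmono : StrictMonoOn F (Set.Icc 0 1))
    (halg : R.IsSMLC M F) {c : ℝ} (hc : 0 < c) :
    Tendsto (fun t => P {ω | ∃ x, c < R.var M t ω x}) atTop (𝓝 0) := by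
  classical
  have hM := h.wellPosed
  obtain ⟨ω₀⟩ : Nonempty Ω := P.nonempty_of_neZero
  set B := R.maxVar M 0 ω₀ with hB
  rcases lt_or_ge B c with hBc | hcB
  · have : ∀ t, {ω | ∃ x, c < R.var M t ω x} = ∅ := by
      intro t
      ext ω
      simp only [Set.mem_ofPred_eq, Set.mem_empty_iff_false, iff_false, not_exists, not_lt]
      exact fun x => (R.var_le_maxVar_zero hD hM t ω ω₀ x).trans hBc.le
    simp_rw [this, measure_empty]
    exact tendsto_const_nhds
  obtain ⟨K, hK⟩ := h.exists_card_learning_le hD hc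
  have hB0 : 0 < B := hc.trans_le hcB
  have hcB' : c / B ∈ Set.Icc (0 : ℝ) 1 := ⟨by positivity, div_le_one_of_le₀ hcB hB0.le⟩
  set p := F (c / B) with hp
  have hpI : p ∈ Set.Icc (0 : ℝ) 1 := hFmaps hcB'
  have hp0 : 0 < p := lt_of_le_of_lt (hFmaps ⟨le_rfl, zero_le_one⟩).1
    (hFmono ⟨le_rfl, zero_le_one⟩ hcB' (by positivity))
  set q : ℝ≥0∞ := ENNReal.ofReal p ^ N with hq
  have hq0 : q ≠ 0 := pow_ne_zero _ (by simpa using hp0)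
  have hqt : q ≠ ∞ := by simp [hq]
  let A : ℕ → Set Ω := fun t => {ω | ∃ x, c < R.var M t ω x}
  let C : ℕ → Set Ω := fun t => {ω | ∀ i, R.coin t i ω < p}
  have hAm' : ∀ t, MeasurableSet[R.sigmaBefore t] (A t) := fun t =>
    measurableSet_exists_lt_var hD hM hFcont halg h.adapted_sigmaBefore t c
  have hCm' : ∀ t, MeasurableSet[⨆ a ∈ Set.range (SMLCSource.coin (s := s) (N := N) (n₀ := n₀) t),
      R.sourceSigma a] (C t) := by
    intro t
    have : C t = ⋂ i, R.coin t i ⁻¹' Set.Iio p := by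
      ext ω; simp [C]
    rw [this]
    refine MeasurableSet.iInter fun i => ?_
    exact le_iSup₂_of_le (f := fun a (_ : a ∈ Set.range (SMLCSource.coin t)) => R.sourceSigma a)
      (.coin t i) ⟨i, rfl⟩ le_rfl _ ⟨Set.Iio p, measurableSet_Iio, rfl⟩
  have hAm : ∀ t, MeasurableSet (A t) := fun t =>
    iSup₂_le (fun a _ => h.sourceSigma_le a) _ (hAm' t)
  have hCm : ∀ t, MeasurableSet (C t) := fun t =>
    iSup₂_le (fun a _ => h.sourceSigma_le a) _ (hCm' t)
  have hind : ∀ t, P (A t ∩ C t) = P (A t) * q := by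
    intro t
    have hdisj : Disjoint (sourcesBefore s N n₀ t) (Set.range (SMLCSource.coin t)) := by
      rw [Set.disjoint_right]
      rintro _ ⟨i, rfl⟩ hi
      exact lt_irrefl t hi
    have := indep_iSup_of_disjoint h.sourceSigma_le h.indep hdisj
    rw [hq, ← h.measure_coin_lt hpI t]
    exact Indep_iff _ _ _ |>.1 this _ _ (hAm' t) (hCm' t)
  -- if the maximal variance exceeds `c` and all random numbers are below `p`, then the agent in
  -- whose cell the variance exceeds `c` learns
  have hlearn : ∀ t, ∀ ω ∈ A t ∩ C t, ∃ i, R.b t i ω = true ∧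
      c ≤ R.var M t ω (R.xmax t i ω) := by
    rintro t ω ⟨⟨x, hx⟩, hC⟩
    obtain ⟨i, hi⟩ := R.exists_mem_cell hN t ω x
    have hle : c ≤ R.var M t ω (R.xmax t i ω) := hx.le.trans (halg.xmax_max t i ω hi)
    refine ⟨i, ?_, hle⟩
    rw [halg.learn, R.maxVarCell_eq halg ⟨x, hi⟩, R.maxVar_zero_eq hM ω ω₀]
    refine ⟨⟨x, hi⟩, (hC i).trans_le ?_⟩
    refine hFmono.monotoneOn hcB' (R.var_div_mem_Icc hD hM t ω ω₀ _) ?_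
    gcongr
  have hsum : ∀ S : Finset ℕ, ∑ t ∈ S, P (A t) * q ≤ K := by
    intro S
    calc ∑ t ∈ S, P (A t) * q = ∑ t ∈ S, ∫⁻ ω, (A t ∩ C t).indicator 1 ω ∂P := by
          refine Finset.sum_congr rfl fun t _ => ?_
          rw [lintegral_indicator_one ((hAm t).inter (hCm t)), hind]
      _ = ∫⁻ ω, ∑ t ∈ S, (A t ∩ C t).indicator 1 ω ∂P :=
          (lintegral_finsetSum _ fun t _ =>
            measurable_one.indicator ((hAm t).inter (hCm t))).symm
      _ ≤ ∫⁻ _, (K : ℝ≥0∞) ∂P := by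
          refine lintegral_mono fun ω => ?_
          have hcard := hK ω (S.filter fun t => ω ∈ A t ∩ C t) fun t ht =>
            hlearn t ω (Finset.mem_filter.1 ht).2
          have : ∑ t ∈ S, (A t ∩ C t).indicator (1 : Ω → ℝ≥0∞) ω =
              ((S.filter fun t => ω ∈ A t ∩ C t).card : ℝ≥0∞) := by
            rw [Finset.card_filter, Nat.cast_sum]
            refine Finset.sum_congr rfl fun t _ => ?_
            by_cases hω : ω ∈ A t ∩ C t <;> simp [hω]
          rw [this]
          exact Nat.cast_le.2 hcard
      _ = K := by simp
  have htsum : ∑' t, P (A t) * q ≠ ∞ := by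
    refine ne_top_of_le_ne_top (ENNReal.natCast_ne_top K) ?_
    rw [ENNReal.tsum_eq_iSup_sum]
    exact iSup_le hsum
  have hlim := ENNReal.tendsto_atTop_zero_of_tsum_ne_top htsum
  have := ENNReal.Tendsto.mul_const (b := q⁻¹) hlim (Or.inr (ENNReal.inv_ne_top.2 hq0))
  rw [zero_mul] at this
  refine this.congr fun t => ?_
  rw [mul_assoc, ENNReal.mul_inv_cancel hq0 hqt, mul_one]

end IsMFGP

end SMLCRun

/-! ### Bayes' rule under adaptive sampling -/

/-- Undoing a decoupling change of measure whose density `W` is the inverse likelihood. -/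
lemma Decoupled.lintegral_eq {Ω : Type*} {𝓓 𝒜 mΩ : MeasurableSpace Ω} {P : Measure Ω}
    [IsProbabilityMeasure P] (h𝓓 : 𝓓 ≤ mΩ) (h𝒜 : 𝒜 ≤ mΩ)
    {W : Ω → ℝ≥0∞} (hW : Measurable W) (hW1 : ∫⁻ ω, W ω ∂P = 1) (hdec : Decoupled P W 𝓓 𝒜)
    {Λ : Ω × Ω → ℝ≥0∞} (hΛ : Measurable[𝓓.prod 𝒜] Λ) (hΛ0 : ∀ p, Λ p ≠ 0) (hΛt : ∀ p, Λ p ≠ ∞)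
    (hWΛ : ∀ ω, W ω = (Λ (ω, ω))⁻¹) {G : Ω × Ω → ℝ≥0∞} (hG : Measurable[𝓓.prod 𝒜] G) :
    ∫⁻ ω, G (ω, ω) ∂P = ∫⁻ ω, W ω * ∫⁻ ω', G (ω', ω) * Λ (ω', ω) ∂P ∂P := by
  have := hdec.lintegral_diag h𝓓 h𝒜 hW hW1 (H := fun p => G p * Λ p) (hG.mul hΛ)
  rw [← this]
  refine lintegral_congr fun ω => ?_
  rw [hWΛ, mul_comm, mul_assoc, ENNReal.mul_inv_cancel (hΛ0 _) (hΛt _), mul_one]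

/-- The posterior expectation of `G`, as a function of the data `ω`; the field, which depends on
`ω'`, has likelihood `Λ (ω', ω)`. The quotient is meaningful if the denominator is neither `0` nor
`∞`. -/
def posteriorExp {Ω : Type*} [MeasurableSpace Ω] (P : Measure Ω) (Λ G : Ω × Ω → ℝ≥0∞) (ω : Ω) :
    ℝ≥0∞ :=
  (∫⁻ ω', G (ω', ω) * Λ (ω', ω) ∂P) / ∫⁻ ω', Λ (ω', ω) ∂P

lemma measurable_lintegral_of_le {Ω : Type*} {𝓓 𝒜 mΩ : MeasurableSpace Ω} {P : Measure Ω}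
    [IsProbabilityMeasure P] (h𝓓 : 𝓓 ≤ mΩ) {H : Ω × Ω → ℝ≥0∞} (hH : Measurable[𝓓.prod 𝒜] H) :
    Measurable[𝒜] fun ω => ∫⁻ ω', H (ω', ω) ∂P := by
  have hfin : @IsFiniteMeasure Ω 𝓓 (P.trim h𝓓) := isFiniteMeasure_trim h𝓓
  have h1 := @Measurable.lintegral_prod_left' Ω Ω 𝓓 𝒜 (P.trim h𝓓) _ H hH
  convert h1 using 2 with ω
  exact (lintegral_trim h𝓓 (@Measurable.comp Ω (Ω × Ω) _ 𝓓 (𝓓.prod 𝒜) _ _ _ hH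
    (@measurable_prodMk_right Ω Ω 𝓓 𝒜 ω))).symm

lemma measurable_posteriorExp {Ω : Type*} {𝓓 𝒜 mΩ : MeasurableSpace Ω} {P : Measure Ω}
    [IsProbabilityMeasure P] (h𝓓 : 𝓓 ≤ mΩ) {Λ G : Ω × Ω → ℝ≥0∞} (hΛ : Measurable[𝓓.prod 𝒜] Λ)
    (hG : Measurable[𝓓.prod 𝒜] G) : Measurable[𝒜] (posteriorExp P Λ G) :=
  (measurable_lintegral_of_le h𝓓 (hG.mul hΛ)).div (measurable_lintegral_of_le h𝓓 hΛ)

/-- Bayes' rule: expectations are averages of posterior expectations. -/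
theorem Decoupled.lintegral_posteriorExp {Ω : Type*} {𝓓 𝒜 mΩ : MeasurableSpace Ω} {P : Measure Ω}
    [IsProbabilityMeasure P] (h𝓓 : 𝓓 ≤ mΩ) (h𝒜 : 𝒜 ≤ mΩ)
    {W : Ω → ℝ≥0∞} (hW : Measurable W) (hW1 : ∫⁻ ω, W ω ∂P = 1) (hdec : Decoupled P W 𝓓 𝒜)
    {Λ : Ω × Ω → ℝ≥0∞} (hΛ : Measurable[𝓓.prod 𝒜] Λ) (hΛ0 : ∀ p, Λ p ≠ 0) (hΛt : ∀ p, Λ p ≠ ∞)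
    (hWΛ : ∀ ω, W ω = (Λ (ω, ω))⁻¹) (hZ0 : ∀ ω, ∫⁻ ω', Λ (ω', ω) ∂P ≠ 0)
    (hZt : ∀ ω, ∫⁻ ω', Λ (ω', ω) ∂P ≠ ∞)
    {G : Ω × Ω → ℝ≥0∞} (hG : Measurable[𝓓.prod 𝒜] G) :
    ∫⁻ ω, G (ω, ω) ∂P = ∫⁻ ω, posteriorExp P Λ G ω ∂P := by
  have hsnd : @Measurable (Ω × Ω) Ω (𝓓.prod 𝒜) 𝒜 Prod.snd := @measurable_snd Ω Ω 𝓓 𝒜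
  have hG' : Measurable[𝓓.prod 𝒜] fun p : Ω × Ω => posteriorExp P Λ G p.2 :=
    @Measurable.comp _ _ _ (𝓓.prod 𝒜) 𝒜 _ _ _ (measurable_posteriorExp h𝓓 hΛ hG) hsnd
  have hle : 𝓓.prod 𝒜 ≤ mΩ.prod mΩ :=
    sup_le_sup (MeasurableSpace.comap_mono h𝓓) (MeasurableSpace.comap_mono h𝒜)
  have hΛ' : Measurable Λ := hΛ.mono hle le_rfl
  rw [hdec.lintegral_eq h𝓓 h𝒜 hW hW1 hΛ hΛ0 hΛt hWΛ hG,
    hdec.lintegral_eq h𝓓 h𝒜 hW hW1 hΛ hΛ0 hΛt hWΛ hG']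
  refine lintegral_congr fun ω => ?_
  congr 1
  have hΛω : Measurable fun ω' => Λ (ω', ω) := hΛ'.comp measurable_prodMk_right
  change _ = ∫⁻ ω', posteriorExp P Λ G ω * Λ (ω', ω) ∂P
  rw [lintegral_const_mul _ hΛω, posteriorExp, ENNReal.div_mul_cancel (hZ0 ω) (hZt ω)]

section Measurability

variable {α β : Type*} [MeasurableSpace β]

lemma measurable_comp_fst {𝓓 𝒜 : MeasurableSpace α} {f : α → β} (hf : Measurable[𝓓] f) :
    Measurable[𝓓.prod 𝒜] fun p : α × α => f p.1 :=
  hf.comp measurable_fst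

lemma measurable_comp_snd {𝓓 𝒜 : MeasurableSpace α} {f : α → β} (hf : Measurable[𝒜] f) :
    Measurable[𝓓.prod 𝒜] fun p : α × α => f p.2 :=
  hf.comp measurable_snd

lemma measurable_comp_diag {𝓓 𝒜 m : MeasurableSpace α} (h𝓓 : 𝓓 ≤ m) (h𝒜 : 𝒜 ≤ m)
    {f : α × α → β} (hf : Measurable[𝓓.prod 𝒜] f) : Measurable[m] fun a => f (a, a) := by
  refine @Measurable.comp α (α × α) β m (𝓓.prod 𝒜) _ f (fun a => (a, a)) hf ?_
  exact Measurable.prodMk (measurable_id'' h𝓓) (measurable_id'' h𝒜)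

lemma measurable_pi_of_apply {m : MeasurableSpace α} {ι : Type*} {f : α → ι → β}
    (hf : ∀ i, Measurable[m] fun a => f a i) : Measurable[m] f :=
  measurable_pi_lambda _ hf

lemma measurable_ite_bool {m : MeasurableSpace α} {b : α → Bool} (hb : Measurable[m] b) {f : α → ℝ}
    (hf : Measurable[m] f) : Measurable[m] fun a => if b a = true then f a else 0 :=
  Measurable.ite (hb (measurableSet_singleton true)) hf measurable_const

lemma measurable_prod_likRatio {m : MeasurableSpace α} {ι : Type*} [Fintype ι] (σ : ι → ℝ)
    {y u : ι → α → ℝ} (hy : ∀ i, Measurable[m] (y i)) (hu : ∀ i, Measurable[m] (u i)) :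
    Measurable[m] fun a => ∏ i, likRatio (σ i) (y i a) (u i a) :=
  Finset.measurable_fun_prod _ fun i _ => (measurable_likRatio (σ i)).comp ((hy i).prodMk (hu i))

end Measurability

namespace SMLCRun

variable {D : Set Plane} {s N n₀ : ℕ} {Ω : Type*} (R : SMLCRun D s N n₀ Ω) (M : MFModel D s)

/-- The signal measured by agent `i` in iteration `t` when the decisions are those of `ω` and the
field is that of `ω'`; it is `0` if the agent does not measure. -/
def signal (t : ℕ) (ω' ω : Ω) (i : Fin N) : ℝ :=
  if R.b t i ω = true then R.φ (Fin.last s) (R.xmax t i ω) ω' else 0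

/-- The signals measured before deployment. -/
def signal₀ (ω : Ω) (j : Fin n₀) : ℝ := R.φ (R.lev₀ j) (R.loc₀ j) ω

/-- The data reported in iteration `t`, completed by pure noise for agents that do not measure. -/
def yFull (t : ℕ) (ω : Ω) : Fin N → ℝ := R.signal t ω ω + fun i => R.noise t i ω

/-- The σ-algebra of all random numbers and of the data reported before iteration `t`. -/
@[reducible] def dataSigma : ℕ → MeasurableSpace Ω
  | 0 => (⨆ a ∈ Set.range fun p : ℕ × Fin N => SMLCSource.coin p.1 p.2, R.sourceSigma a) ⊔
      MeasurableSpace.comap (fun ω => R.signal₀ ω + fun j => R.noise₀ j ω) inferInstance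
  | t + 1 => dataSigma t ⊔ MeasurableSpace.comap (fun ω => R.yFull t ω) inferInstance

/-- The likelihood, given the data of `ω` before iteration `t`, of the field of `ω'`; decisions and
sampling points are those of `ω`. Agents that do not measure contribute a factor `1`. -/
def likFull : ℕ → Ω × Ω → ℝ≥0∞
  | 0, p => ∏ j, likRatio (M.σ (R.lev₀ j)) (R.y₀ j p.2) (R.signal₀ p.1 j)
  | t + 1, p => likFull t p *
      ∏ i, likRatio (M.σ (Fin.last s)) (R.yFull t p.2 i) (R.signal t p.1 p.2 i)

lemma likFull_eq_lik (t : ℕ) (ω' ω : Ω) : R.likFull M t (ω', ω) =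
    lik (fun a => M.σ (R.obsLev t ω a)) (R.obsVal t ω)
      (fun a => R.φ (R.obsLev t ω a) (R.obsLoc t ω a) ω') := by
  have h1 : R.likFull M t (ω', ω) =
      (∏ j, likRatio (M.σ (R.lev₀ j)) (R.y₀ j ω) (R.signal₀ ω' j)) *
      ∏ u ∈ Finset.range t, ∏ i,
        likRatio (M.σ (Fin.last s)) (R.yFull u ω i) (R.signal u ω' ω i) := by
    induction t with
    | zero => simp [likFull]
    | succ t ih => rw [likFull, ih, Finset.prod_range_succ, mul_assoc]
  rw [h1, lik, Fintype.prod_sum_type]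
  congr 1
  rw [Finset.prod_range, ← Fintype.prod_prod_type' (fun (u : Fin t) (i : Fin N) =>
    likRatio (M.σ (Fin.last s)) (R.yFull u ω i) (R.signal u ω' ω i))]
  have h2 : ∀ p : Fin t × Fin N,
      likRatio (M.σ (Fin.last s)) (R.yFull p.1 ω p.2) (R.signal p.1 ω' ω p.2) =
      if R.b p.1 p.2 ω = true then likRatio (M.σ (Fin.last s)) (R.y p.1 p.2 ω)
        (R.φ (Fin.last s) (R.xmax p.1 p.2 ω) ω') else 1 := by
    intro p
    by_cases hb : R.b p.1 p.2 ω = true <;> simp [signal, yFull, y, hb]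
  simp_rw [h2]
  rw [← Finset.prod_filter]
  exact Finset.prod_subtype (p := fun p : Fin t × Fin N => R.b p.1 p.2 ω = true)
    (Finset.univ.filter fun p : Fin t × Fin N => R.b p.1 p.2 ω = true) (by simp)
    (fun p : Fin t × Fin N => likRatio (M.σ (Fin.last s)) (R.y p.1 p.2 ω)
        (R.φ (Fin.last s) (R.xmax p.1 p.2 ω) ω'))

/-- All sources but the noise from iteration `t` on. -/
def sourcesWithoutNoise (s N n₀ t : ℕ) : Set (SMLCSource s N n₀) :=
  {a | match a with
    | .field _ => True
    | .noise₀ _ => True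
    | .noise t' _ => t' < t
    | .coin _ _ => True}

/-- The σ-algebra of all sources but the noise from iteration `t` on. -/
@[reducible] def sigmaWithoutNoise (t : ℕ) : MeasurableSpace Ω :=
  ⨆ a ∈ sourcesWithoutNoise s N n₀ t, R.sourceSigma a

variable {R M}

lemma sourceSigma_le_sigmaWithoutNoise {a : SMLCSource s N n₀} {t : ℕ}
    (ha : a ∈ sourcesWithoutNoise s N n₀ t) : R.sourceSigma a ≤ R.sigmaWithoutNoise t :=
  le_iSup₂_of_le a ha le_rfl

lemma fieldSigma_le_sigmaWithoutNoise (t : ℕ) : R.fieldSigma ≤ R.sigmaWithoutNoise t :=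
  iSup_le fun f => sourceSigma_le_sigmaWithoutNoise (a := .field f) trivial

lemma sigmaWithoutNoise_le_succ (t : ℕ) : R.sigmaWithoutNoise t ≤ R.sigmaWithoutNoise (t + 1) := by
  refine biSup_mono fun a ha => ?_
  cases a with
  | field f => trivial
  | noise₀ j => trivial
  | noise u i => exact Nat.lt_succ_of_lt ha
  | coin u i => trivial

lemma dataSigma_mono : Monotone R.dataSigma := monotone_nat_of_le_succ fun _ => le_sup_left

lemma measurable_dataSigma_coin (t u : ℕ) (i : Fin N) :
    Measurable[R.dataSigma t] (R.coin u i) := by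
  refine (comap_measurable (R.coin u i)).mono ?_ le_rfl
  refine le_trans ?_ (dataSigma_mono (Nat.zero_le t))
  exact le_sup_of_le_left (le_iSup₂_of_le (f := fun a
    (_ : a ∈ Set.range fun p : ℕ × Fin N => SMLCSource.coin p.1 p.2) => R.sourceSigma a)
    (.coin u i) ⟨(u, i), rfl⟩ le_rfl)

lemma measurable_dataSigma_y₀ (t : ℕ) (j : Fin n₀) : Measurable[R.dataSigma t] (R.y₀ j) := by
  have h1 : Measurable[R.dataSigma 0] fun ω => R.signal₀ ω + fun j => R.noise₀ j ω :=
    (comap_measurable _).mono le_sup_right le_rfl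
  exact ((measurable_pi_apply j).comp h1).mono (dataSigma_mono (Nat.zero_le t)) le_rfl

lemma measurable_dataSigma_yFull (t : ℕ) : Measurable[R.dataSigma (t + 1)] (R.yFull t) :=
  (comap_measurable (R.yFull t)).mono le_sup_right le_rfl

lemma adapted_dataSigma : R.Adapted R.dataSigma where
  mono := dataSigma_mono
  y₀ j := measurable_dataSigma_y₀ 0 j
  coin t i := measurable_dataSigma_coin (t + 1) t i
  yObs t i _ hb := by
    have h1 : Measurable[R.dataSigma (t + 1)] fun ω => R.yFull t ω i :=
      (measurable_pi_apply i).comp (measurable_dataSigma_yFull t)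
    have h2 : R.yObs t i = fun ω => if R.b t i ω = true then R.yFull t ω i else 0 := by
      funext ω
      by_cases hbω : R.b t i ω = true <;> simp [yObs, yFull, signal, y, hbω]
    rw [h2]
    exact Measurable.ite (hb (measurableSet_singleton true)) h1 measurable_const

lemma measurable_dataSigma_b (hM : M.WellPosed) (hD : IsCompact D) {F : ℝ → ℝ}
    (hF : ContinuousOn F (Set.Icc 0 1)) (halg : R.IsSMLC M F) (t : ℕ) (i : Fin N) :
    Measurable[R.dataSigma t] (R.b t i) := by
  obtain ⟨hg, hxt, hb, hx, -⟩ := adapted_dataSigma.measurable hF halg hD hM t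
  have hvar := @measurable_var _ _ _ _ _ R _ (R.dataSigma t) t hM hb hx
  exact @measurable_b _ _ _ _ _ R _ (R.dataSigma t) t F hF halg hD hM hg hvar i (hxt i)
    (measurable_dataSigma_coin t t i)

namespace IsMFGP

variable [mΩ : MeasurableSpace Ω] {P : Measure Ω}

lemma sigmaWithoutNoise_le (h : R.IsMFGP M P) (t : ℕ) : R.sigmaWithoutNoise t ≤ mΩ :=
  iSup₂_le fun a _ => h.sourceSigma_le a

lemma measurable_signal (h : R.IsMFGP M P) [IsProbabilityMeasure P] (hD : IsCompact D) {F : ℝ → ℝ}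
    (hF : ContinuousOn F (Set.Icc 0 1)) (halg : R.IsSMLC M F) (t : ℕ) :
    Measurable[R.fieldSigma.prod (R.dataSigma t)]
      fun p : Ω × Ω => R.signal t p.1 p.2 := by
  have hM := h.wellPosed
  refine measurable_pi_of_apply fun i => ?_
  have hx : Measurable[R.fieldSigma.prod (R.dataSigma t)] fun p : Ω × Ω => R.xmax t i p.2 :=
    measurable_comp_snd ((adapted_dataSigma.measurable hF halg hD hM t).2.1 i)
  exact measurable_ite_bool (measurable_comp_snd (measurable_dataSigma_b hM hD hF halg t i))
    (h.measurable_φ_comp (mΩ := mΩ) (@measurable_fst Ω Ω R.fieldSigma (R.dataSigma t))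
      (Fin.last s) hx)

lemma measurable_signal_diag (h : R.IsMFGP M P) [IsProbabilityMeasure P] (hD : IsCompact D)
    {F : ℝ → ℝ} (hF : ContinuousOn F (Set.Icc 0 1)) (halg : R.IsSMLC M F) (t : ℕ) :
    Measurable[R.fieldSigma ⊔ R.dataSigma t] fun ω => R.signal t ω ω :=
  measurable_comp_diag le_sup_left le_sup_right (h.measurable_signal hD hF halg t)

lemma measurable_signal₀ (h : R.IsMFGP M P) : Measurable[R.fieldSigma] R.signal₀ :=
  measurable_pi_of_apply fun _ => h.measurable_field_φ _ _

lemma measurable_likFull (h : R.IsMFGP M P) [IsProbabilityMeasure P] (hD : IsCompact D) {F : ℝ → ℝ}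
    (hF : ContinuousOn F (Set.Icc 0 1)) (halg : R.IsSMLC M F) (t : ℕ) :
    Measurable[R.fieldSigma.prod (R.dataSigma t)] (R.likFull M t) := by
  induction t with
  | zero =>
    exact measurable_prod_likRatio (fun j => M.σ (R.lev₀ j))
      (fun j => measurable_comp_snd (measurable_dataSigma_y₀ 0 j))
      (fun j => measurable_comp_fst (h.measurable_field_φ (R.lev₀ j) (R.loc₀ j)))
  | succ t ih =>
    have hle : R.fieldSigma.prod (R.dataSigma t) ≤ R.fieldSigma.prod (R.dataSigma (t + 1)) :=
      sup_le_sup le_rfl (MeasurableSpace.comap_mono (dataSigma_mono (Nat.le_succ t)))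
    have h1 : ∀ i, Measurable[R.dataSigma (t + 1)] fun ω => R.yFull t ω i := fun i =>
      (measurable_pi_apply i).comp (measurable_dataSigma_yFull t)
    have h2 : ∀ i, Measurable[R.fieldSigma.prod (R.dataSigma (t + 1))]
        fun p : Ω × Ω => R.signal t p.1 p.2 i := fun i =>
      ((measurable_pi_apply i).comp (h.measurable_signal hD hF halg t)).mono hle le_rfl
    exact (ih.mono hle le_rfl).mul (measurable_prod_likRatio (fun _ => M.σ (Fin.last s))
      (fun i => measurable_comp_snd (h1 i)) h2)

omit mΩ in
lemma _root_.SMLCRun.likFull_ne_zero (t : ℕ) (p : Ω × Ω) : R.likFull M t p ≠ 0 := by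
  rw [← Prod.mk.eta (p := p), R.likFull_eq_lik]
  exact lik_ne_zero _ _ _

omit mΩ in
lemma _root_.SMLCRun.likFull_ne_top (t : ℕ) (p : Ω × Ω) : R.likFull M t p ≠ ∞ := by
  rw [← Prod.mk.eta (p := p), R.likFull_eq_lik]
  exact lik_ne_top _ _ _

lemma map_noise (h : R.IsMFGP M P) [IsProbabilityMeasure P] (t : ℕ) :
    P.map (fun ω i => R.noise t i ω) = noiseLaw fun _ : Fin N => M.σ (Fin.last s) := by
  have hind : iIndepFun (fun i => R.noise t i) P := by
    rw [iIndepFun_iff_iIndep]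
    exact h.indep.precomp (g := SMLCSource.noise t) fun a b hab => by simpa using hab
  rw [(iIndepFun_iff_map_fun_eq_pi_map fun i => (h.noise_meas t i).aemeasurable).1 hind, noiseLaw]
  simp_rw [h.noise_law]

lemma map_noise₀ (h : R.IsMFGP M P) [IsProbabilityMeasure P] :
    P.map (fun ω j => R.noise₀ j ω) = noiseLaw fun j => M.σ (R.lev₀ j) := by
  have hind : iIndepFun R.noise₀ P := by
    rw [iIndepFun_iff_iIndep]
    exact h.indep.precomp (g := SMLCSource.noise₀) fun a b hab => by simpa using hab
  rw [(iIndepFun_iff_map_fun_eq_pi_map fun j => (h.noise₀_meas j).aemeasurable).1 hind, noiseLaw]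
  simp_rw [h.noise₀_law]

/-- Reweighting by the inverse likelihood decouples the field from the data. -/
theorem decoupled (h : R.IsMFGP M P) [IsProbabilityMeasure P] (hD : IsCompact D) {F : ℝ → ℝ}
    (hF : ContinuousOn F (Set.Icc 0 1)) (halg : R.IsSMLC M F) (t : ℕ) :
    R.dataSigma t ≤ R.sigmaWithoutNoise t ∧
    Measurable[R.sigmaWithoutNoise t] (fun ω => (R.likFull M t (ω, ω))⁻¹) ∧
    ∫⁻ ω, (R.likFull M t (ω, ω))⁻¹ ∂P = 1 ∧
    Decoupled P (fun ω => (R.likFull M t (ω, ω))⁻¹) R.fieldSigma (R.dataSigma t) := by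
  have hpair : ∀ t, R.dataSigma t ≤ R.sigmaWithoutNoise t →
      Measurable[R.sigmaWithoutNoise t] (fun ω => (R.likFull M t (ω, ω))⁻¹) := fun t ht =>
    (measurable_comp_diag (fieldSigma_le_sigmaWithoutNoise t) ht
      (h.measurable_likFull hD hF halg t)).inv
  induction t with
  | zero =>
    let S : Set (SMLCSource s N n₀) := Set.range SMLCSource.field
    let C : Set (SMLCSource s N n₀) := Set.range fun p : ℕ × Fin N => SMLCSource.coin p.1 p.2
    let E : Set (SMLCSource s N n₀) := Set.range SMLCSource.noise₀
    have hfS : R.fieldSigma = ⨆ a ∈ S, R.sourceSigma a := by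
      rw [iSup_range]
    have hE : MeasurableSpace.comap (fun ω j => R.noise₀ j ω) inferInstance ≤
        ⨆ a ∈ E, R.sourceSigma a := by
      refine Measurable.comap_le (measurable_pi_of_apply fun j => ?_)
      exact (comap_measurable (R.noise₀ j)).mono
        (le_iSup₂_of_le (f := fun a (_ : a ∈ E) => R.sourceSigma a) (.noise₀ j) ⟨j, rfl⟩ le_rfl)
        le_rfl
    have hSC : Disjoint S C := by
      rw [Set.disjoint_left]; rintro _ ⟨f, rfl⟩ ⟨p, hp⟩; cases hp
    have hSCE : Disjoint (S ∪ C) E := by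
      rw [Set.disjoint_left]; rintro _ (⟨f, rfl⟩ | ⟨p, rfl⟩) ⟨j, hj⟩ <;> cases hj
    have hindSC := indep_iSup_of_disjoint h.sourceSigma_le h.indep hSC
    have hindE := indep_iSup_of_disjoint h.sourceSigma_le h.indep hSCE
    have hdec : Decoupled P (fun _ => 1) R.fieldSigma (⨆ a ∈ C, R.sourceSigma a) := by
      intro A B hA hB
      rw [setLIntegral_one, setLIntegral_one]
      rw [hfS] at hA
      exact (Indep_iff _ _ _).1 hindSC A B hA hB
    have hlS : R.fieldSigma ≤ ⨆ a ∈ S ∪ C, R.sourceSigma a := by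
      rw [hfS]; exact biSup_mono fun a ha => Or.inl ha
    obtain ⟨h1, h2⟩ := hdec.measure (𝓑 := ⨆ a ∈ S ∪ C, R.sourceSigma a)
      (iSup₂_le fun a _ => h.sourceSigma_le a) hlS (biSup_mono fun a ha => Or.inr ha)
      measurable_const (by simp)
      (fun j => M.σ_pos (R.lev₀ j)) (ε := fun ω j => R.noise₀ j ω)
      (measurable_pi_lambda _ h.noise₀_meas) (indep_of_indep_of_le_right hindE hE) h.map_noise₀
      (s := R.signal₀) (h.measurable_signal₀.mono hlS le_rfl)
    have hW : ∀ ω, (1 : ℝ≥0∞) * ∏ j, (likRatio (M.σ (R.lev₀ j)) (R.signal₀ ω j + R.noise₀ j ω)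
        (R.signal₀ ω j))⁻¹ = (R.likFull M 0 (ω, ω))⁻¹ := by
      intro ω
      rw [one_mul, likFull, ENNReal.prod_inv_distrib]
      · rfl
      · exact fun j _ _ _ _ => Or.inl (likRatio_ne_zero _ _ _)
    simp_rw [hW] at h1 h2
    have hle : R.dataSigma 0 ≤ R.sigmaWithoutNoise 0 := by
      refine sup_le (biSup_mono ?_) (Measurable.comap_le ?_)
      · rintro _ ⟨p, rfl⟩; trivial
      · refine (h.measurable_signal₀.mono (fieldSigma_le_sigmaWithoutNoise 0) le_rfl).add
          (measurable_pi_of_apply fun j => ?_)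
        exact (comap_measurable (R.noise₀ j)).mono
          (sourceSigma_le_sigmaWithoutNoise (a := .noise₀ j) trivial) le_rfl
    exact ⟨hle, hpair 0 hle, h1, h2⟩
  | succ t ih =>
    obtain ⟨hle, hm, h1, hdec⟩ := ih
    let E : Set (SMLCSource s N n₀) := Set.range (SMLCSource.noise t)
    have hE : MeasurableSpace.comap (fun ω i => R.noise t i ω) inferInstance ≤
        ⨆ a ∈ E, R.sourceSigma a := by
      refine Measurable.comap_le (measurable_pi_of_apply fun i => ?_)
      exact (comap_measurable (R.noise t i)).mono
        (le_iSup₂_of_le (f := fun a (_ : a ∈ E) => R.sourceSigma a) (.noise t i) ⟨i, rfl⟩ le_rfl)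
        le_rfl
    have hdisj : Disjoint (sourcesWithoutNoise s N n₀ t) E := by
      rw [Set.disjoint_right]; rintro _ ⟨i, rfl⟩ hi; exact lt_irrefl t hi
    have hind := indep_iSup_of_disjoint h.sourceSigma_le h.indep hdisj
    have hsig : Measurable[R.sigmaWithoutNoise t] fun ω => R.signal t ω ω :=
      (h.measurable_signal_diag hD hF halg t).mono
        (sup_le (fieldSigma_le_sigmaWithoutNoise t) hle) le_rfl
    obtain ⟨h2, h3⟩ := hdec.measure (h.sigmaWithoutNoise_le t) (fieldSigma_le_sigmaWithoutNoise t)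
      hle hm h1 (fun _ : Fin N => M.σ_pos (Fin.last s)) (ε := fun ω i => R.noise t i ω)
      (measurable_pi_lambda _ (h.noise_meas t)) (indep_of_indep_of_le_right hind hE)
      (h.map_noise t) hsig
    have hW : ∀ ω, (R.likFull M t (ω, ω))⁻¹ * ∏ i, (likRatio (M.σ (Fin.last s))
        (R.signal t ω ω i + R.noise t i ω) (R.signal t ω ω i))⁻¹ =
        (R.likFull M (t + 1) (ω, ω))⁻¹ := by
      intro ω
      rw [likFull, ENNReal.mul_inv (Or.inl (likFull_ne_zero _ _)) (Or.inl (likFull_ne_top _ _)),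
        ENNReal.prod_inv_distrib]
      · rfl
      · exact fun j _ _ _ _ => Or.inl (likRatio_ne_zero _ _ _)
    simp_rw [hW] at h2 h3
    have hle' : R.dataSigma (t + 1) ≤ R.sigmaWithoutNoise (t + 1) := by
      refine sup_le (hle.trans (sigmaWithoutNoise_le_succ t)) (Measurable.comap_le ?_)
      refine (hsig.mono (sigmaWithoutNoise_le_succ t) le_rfl).add
        (measurable_pi_of_apply fun i => ?_)
      exact (comap_measurable (R.noise t i)).mono
        (sourceSigma_le_sigmaWithoutNoise (a := .noise t i) (Nat.lt_succ_self t)) le_rfl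
    exact ⟨hle', hpair (t + 1) hle', h2, h3⟩

/-- Bayes' rule for a run: `P` averages the posterior expectations given the data collected before
iteration `t`. -/
theorem lintegral_posteriorExp (h : R.IsMFGP M P) [IsProbabilityMeasure P] (hD : IsCompact D)
    {F : ℝ → ℝ} (hF : ContinuousOn F (Set.Icc 0 1)) (halg : R.IsSMLC M F) (t : ℕ)
    {G : Ω × Ω → ℝ≥0∞} (hG : Measurable[R.fieldSigma.prod (R.dataSigma t)] G) :
    Measurable (posteriorExp P (R.likFull M t) G) ∧
    ∫⁻ ω, G (ω, ω) ∂P = ∫⁻ ω, posteriorExp P (R.likFull M t) G ω ∂P := by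
  obtain ⟨hle, hm, h1, hdec⟩ := h.decoupled hD hF halg t
  have h𝒜 : R.dataSigma t ≤ mΩ := hle.trans (h.sigmaWithoutNoise_le t)
  have hΛ := h.measurable_likFull hD hF halg t
  refine ⟨(measurable_posteriorExp h.fieldSigma_le hΛ hG).mono h𝒜 le_rfl,
    hdec.lintegral_posteriorExp h.fieldSigma_le h𝒜 (hm.mono (h.sigmaWithoutNoise_le t) le_rfl) h1
      hΛ (likFull_ne_zero t) (likFull_ne_top t) (fun _ => rfl) (fun ω => ?_) (fun ω => ?_) hG⟩
  · simp_rw [R.likFull_eq_lik]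
    exact lintegral_lik_ne_zero (fun a => h.measurable_φ _ _) _ _
  · simp_rw [R.likFull_eq_lik]
    exact lintegral_lik_ne_top _ _ _

end IsMFGP

end SMLCRun

/-! ### From the posterior to the estimate -/

lemma half_le_gaussianReal_abs_le (m : ℝ) (v : ℝ≥0) :
    2⁻¹ ≤ gaussianReal m v {z | |m| ≤ |z|} := by
  wlog hm : 0 ≤ m generalizing m
  · have h1 := this (-m) (by linarith)
    have hE : MeasurableSet {z : ℝ | |(-m)| ≤ |z|} :=
      measurableSet_le measurable_const measurable_norm
    rw [← gaussianReal_map_neg, Measure.map_apply measurable_neg hE] at h1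
    simpa [Set.preimage, abs_neg] using h1
  -- the law is symmetric about `m`, so that one of two complementary half-lines has mass `1/2`
  have h1 : gaussianReal m v (Set.Iic m) = gaussianReal m v (Set.Ici m) := by
    have h2 : gaussianReal m v = (gaussianReal m v).map fun z => 2 * m - z := by
      rw [gaussianReal_map_const_sub]; congr 1; ring
    nth_rw 1 [h2]
    rw [Measure.map_apply (by fun_prop) measurableSet_Iic]
    congr 1
    ext z
    simp only [Set.mem_preimage, Set.mem_Iic, Set.mem_Ici]
    constructor <;> intro h <;> linarith
  have h2 : 1 ≤ gaussianReal m v (Set.Ici m) * 2 := by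
    calc (1 : ℝ≥0∞) = gaussianReal m v Set.univ := measure_univ.symm
      _ = gaussianReal m v (Set.Iic m ∪ Set.Ici m) := by rw [Set.Iic_union_Ici]
      _ ≤ gaussianReal m v (Set.Iic m) + gaussianReal m v (Set.Ici m) := measure_union_le _ _
      _ = gaussianReal m v (Set.Ici m) * 2 := by rw [h1, mul_two]
  calc (2⁻¹ : ℝ≥0∞) ≤ gaussianReal m v (Set.Ici m) := by
        rw [← one_div]; exact ENNReal.div_le_of_le_mul h2
    _ ≤ _ := measure_mono fun z hz => by
        have : m ≤ z := hz
        simpa [abs_of_nonneg hm] using this.trans (le_abs_self z)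

lemma gaussianReal_lt_abs_sub_le (m : ℝ) (v : ℝ≥0) {η : ℝ} (hη : 0 < η) :
    gaussianReal m v {z | η < |z - m|} ≤ ENNReal.ofReal (v / η ^ 2) := by
  have h1 := meas_ge_le_variance_div_sq (memLp_id_gaussianReal (μ := m) (v := v) 2) hη
  rw [variance_id_gaussianReal] at h1
  refine (measure_mono fun z hz => ?_).trans h1
  have : η < |z - m| := hz
  simpa [integral_id_gaussianReal] using this.le

lemma posteriorExp_mono {Ω : Type*} [MeasurableSpace Ω] {P : Measure Ω} {Λ G H : Ω × Ω → ℝ≥0∞}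
    {ω : Ω} (h : ∀ ω', G (ω', ω) ≤ H (ω', ω)) : posteriorExp P Λ G ω ≤ posteriorExp P Λ H ω :=
  ENNReal.div_le_div_right (lintegral_mono fun ω' => mul_le_mul_left (h ω') _) _

namespace SMLCRun

variable {D : Set Plane} {s N n₀ : ℕ} {Ω : Type*} {R : SMLCRun D s N n₀ Ω} {M : MFModel D s}

/-- The event that the sensory function varies by more than `η` within distance `h`. -/
def oscSet (R : SMLCRun D s N n₀ Ω) (η h : ℝ) : Set Ω :=
  {ω | ∃ x x' : D, dist x x' < h ∧ η < |R.φ (Fin.last s) x ω - R.φ (Fin.last s) x' ω|}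

namespace IsMFGP

variable [mΩ : MeasurableSpace Ω] {P : Measure Ω}

lemma measurableSet_oscSet (h : R.IsMFGP M P) (η r : ℝ) :
    MeasurableSet[R.fieldSigma] (R.oscSet η r) := by
  obtain ⟨Z, hZc, hZ⟩ := TopologicalSpace.exists_countable_dense (D × D)
  have hset : R.oscSet η r = ⋃ p ∈ Z, {ω | dist p.1 p.2 < r ∧
      η < |R.φ (Fin.last s) p.1 ω - R.φ (Fin.last s) p.2 ω|} := by
    ext ω
    simp only [Set.mem_iUnion, exists_prop]
    refine ⟨fun ⟨x, x', hx⟩ => ?_, fun ⟨p, _, hp⟩ => ⟨p.1, p.2, hp⟩⟩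
    have hφ := h.continuous_φ (Fin.last s) ω
    have hopen : IsOpen {p : D × D | dist p.1 p.2 < r ∧
        η < |R.φ (Fin.last s) p.1 ω - R.φ (Fin.last s) p.2 ω|} :=
      (isOpen_lt continuous_dist continuous_const).and (isOpen_lt continuous_const
        ((hφ.comp continuous_fst).sub (hφ.comp continuous_snd)).abs)
    exact hZ.exists_mem_open hopen ⟨(x, x'), hx⟩
  rw [hset]
  refine MeasurableSet.biUnion hZc fun p _ => ?_
  have h1 : Measurable[R.fieldSigma] fun ω =>
      |R.φ (Fin.last s) p.1 ω - R.φ (Fin.last s) p.2 ω| :=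
    continuous_abs.measurable.comp ((h.measurable_field_φ _ _).sub (h.measurable_field_φ _ _))
  exact (MeasurableSet.const _).inter (h1 measurableSet_Ioi)

lemma tendsto_measure_oscSet (h : R.IsMFGP M P) [IsProbabilityMeasure P] (hD : IsCompact D) {η : ℝ}
    (hη : 0 < η) : Tendsto (fun n : ℕ => P (R.oscSet η (1 / ((n : ℝ) + 1)))) atTop (𝓝 0) := by
  have : CompactSpace D := isCompact_iff_compactSpace.1 hD
  have hempty : ⋂ n : ℕ, R.oscSet η (1 / ((n : ℝ) + 1)) = ∅ := by
    rw [Set.eq_empty_iff_forall_notMem]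
    intro ω hω
    have huc := CompactSpace.uniformContinuous_of_continuous (h.continuous_φ (Fin.last s) ω)
    obtain ⟨r, hr, hφ⟩ := Metric.uniformContinuous_iff.1 huc η hη
    obtain ⟨n, hn⟩ := exists_nat_one_div_lt hr
    obtain ⟨x, x', hxx, hlt⟩ := Set.mem_iInter.1 hω n
    exact lt_irrefl _ (hlt.trans (hφ (hxx.trans hn)))
  rw [← measure_empty (μ := P), ← hempty]
  refine tendsto_measure_iInter_atTop (fun n =>
    (h.fieldSigma_le _ (h.measurableSet_oscSet _ _)).nullMeasurableSet) ?_ ⟨0, measure_ne_top _ _⟩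
  rintro m n hmn ω ⟨x, x', hxx, hlt⟩
  exact ⟨x, x', hxx.trans_le (Nat.one_div_le_one_div hmn), hlt⟩

/-- Given the data, the sensory function at a point (`c = 0`) and its increments (`c = 1`) are
Gaussian about the values for the estimate. -/
lemma exists_posteriorExp_eq (h : R.IsMFGP M P) [IsProbabilityMeasure P] (t : ℕ) (ω : Ω) (x x' : D)
    (c : ℝ) : ∃ v : ℝ≥0, (c = 0 → (v : ℝ) = R.var M t ω x) ∧
      ∀ E, MeasurableSet E → ∀ G : Ω × Ω → ℝ≥0∞,
        (∀ ω', G (ω', ω) = E.indicator 1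
          (R.φ (Fin.last s) x ω' - c * R.φ (Fin.last s) x' ω')) →
        posteriorExp P (R.likFull M t) G ω =
          gaussianReal (R.est M t ω x - c * R.est M t ω x') v E := by
  obtain ⟨v, hv, hE⟩ := h.posterior (R.obsLev t ω) (R.obsLoc t ω) (R.obsVal t ω) x x' c
  refine ⟨v, hv, fun E hEm G hG => ?_⟩
  have hφ : Measurable fun ω' => R.φ (Fin.last s) x ω' - c * R.φ (Fin.last s) x' ω' :=
    (h.measurable_φ _ _).sub ((h.measurable_φ _ _).const_mul c)
  have h1 : ∫⁻ ω', G (ω', ω) * R.likFull M t (ω', ω) ∂P =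
      ∫⁻ ω' in (fun ω' => R.φ (Fin.last s) x ω' - c * R.φ (Fin.last s) x' ω') ⁻¹' E,
        R.likFull M t (ω', ω) ∂P := by
    rw [← lintegral_indicator (hφ hEm)]
    refine lintegral_congr fun ω' => ?_
    rw [hG]
    by_cases hω : R.φ (Fin.last s) x ω' - c * R.φ (Fin.last s) x' ω' ∈ E <;>
      simp [hω]
  rw [posteriorExp, h1]
  simp_rw [R.likFull_eq_lik]
  rw [hE E hEm]
  rw [mul_comm]
  exact ENNReal.mul_div_cancel_right
    (lintegral_lik_ne_zero (fun a => h.measurable_φ _ _) _ _) (lintegral_lik_ne_top _ _ _)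

/-- Where the estimate varies by more than `η` within distance `r`, the posterior probability that
the sensory function does so is at least `1/2`. -/
lemma half_le_posteriorExp_oscSet (h : R.IsMFGP M P) [IsProbabilityMeasure P] {t : ℕ} {ω : Ω}
    {η r : ℝ} {x x' : D} (hxx : dist x x' < r) (hη : η < |R.est M t ω x - R.est M t ω x'|) :
    2⁻¹ ≤ posteriorExp P (R.likFull M t) (fun p => (R.oscSet η r).indicator 1 p.1) ω := by
  obtain ⟨v, -, hv⟩ := h.exists_posteriorExp_eq t ω x x' 1
  let m := R.est M t ω x - R.est M t ω x'
  let E : Set ℝ := {z | |m| ≤ |z|}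
  have hE : MeasurableSet E := measurableSet_le measurable_const measurable_norm
  have h1 := half_le_gaussianReal_abs_le m v
  have h2 := hv E hE
    (fun p => E.indicator 1 (R.φ (Fin.last s) x p.1 - 1 * R.φ (Fin.last s) x' p.1)) fun _ => rfl
  rw [one_mul] at h2
  refine (h1.trans_eq h2.symm).trans (posteriorExp_mono fun ω' => ?_)
  by_cases hω' : |m| ≤ |R.φ (Fin.last s) x ω' - R.φ (Fin.last s) x' ω'|
  · have hmem : ω' ∈ R.oscSet η r := ⟨x, x', hxx, hη.trans_le hω'⟩
    simp only [Set.indicator_of_mem hmem]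
    exact Set.indicator_le_self' (fun _ _ => zero_le_one) _
  · have hmem : R.φ (Fin.last s) x ω' - 1 * R.φ (Fin.last s) x' ω' ∉ E := by
      rw [one_mul]; exact hω'
    simp only [Set.indicator_of_notMem hmem]
    exact bot_le

/-- A bound for the probability that the estimate is far from the sensory function at a point. -/
lemma measure_lt_abs_est_sub_le (h : R.IsMFGP M P) [IsProbabilityMeasure P] (hD : IsCompact D)
    {F : ℝ → ℝ} (hF : ContinuousOn F (Set.Icc 0 1)) (halg : R.IsSMLC M F) (t : ℕ) {η : ℝ}
    (hη : 0 < η) (c : ℝ) (x : D) :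
    P {ω | η < |R.est M t ω x - R.φ (Fin.last s) x ω|} ≤
      P {ω | ∃ x, c < R.var M t ω x} + ENNReal.ofReal (c / η ^ 2) := by
  have hM := h.wellPosed
  obtain ⟨-, -, hb, hx, hy⟩ := adapted_dataSigma.measurable hF halg hD hM t
  have hest : Measurable[R.dataSigma t] fun ω => R.est M t ω x :=
    (@measurable_est _ _ _ _ _ R _ (R.dataSigma t) t hM (measurable_dataSigma_y₀ t) hb hx hy).comp
      (@measurable_prodMk_right Ω D (R.dataSigma t) _ x)
  have hφ := h.measurable_field_φ (Fin.last s) x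
  let G : Ω × Ω → ℝ≥0∞ := fun p =>
    {z : ℝ | η < |z|}.indicator 1 (R.est M t p.2 x - R.φ (Fin.last s) x p.1)
  have hG : Measurable[R.fieldSigma.prod (R.dataSigma t)] G :=
    (measurable_one.indicator (measurableSet_lt measurable_const measurable_norm)).comp
      ((measurable_comp_snd hest).sub (measurable_comp_fst hφ))
  have h𝒜 : R.dataSigma t ≤ mΩ :=
    (h.decoupled hD hF halg t).1.trans (h.sigmaWithoutNoise_le t)
  have hset : MeasurableSet {ω | η < |R.est M t ω x - R.φ (Fin.last s) x ω|} :=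
    measurableSet_lt measurable_const
      (((hest.mono h𝒜 le_rfl).sub (h.measurable_φ (Fin.last s) x)).norm)
  have hA : MeasurableSet {ω | ∃ x, c < R.var M t ω x} :=
    h𝒜 _ (measurableSet_exists_lt_var hD hM hF halg adapted_dataSigma t c)
  have h1 : P {ω | η < |R.est M t ω x - R.φ (Fin.last s) x ω|} = ∫⁻ ω, G (ω, ω) ∂P := by
    rw [← lintegral_indicator_one hset]; rfl
  rw [h1, (h.lintegral_posteriorExp hD hF halg t hG).2]
  calc ∫⁻ ω, posteriorExp P (R.likFull M t) G ω ∂P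
      ≤ ∫⁻ ω, ({ω | ∃ x, c < R.var M t ω x}.indicator 1 ω + ENNReal.ofReal (c / η ^ 2)) ∂P := by
        refine lintegral_mono fun ω => ?_
        obtain ⟨v, hv, hv'⟩ := h.exists_posteriorExp_eq t ω x x 0
        have h2 := hv' {z | η < |z - R.est M t ω x|}
          (measurableSet_lt measurable_const (measurable_id.sub_const _).norm) G fun ω' => by
            simp [G, Set.indicator_apply, abs_sub_comm]
        rw [zero_mul, sub_zero] at h2
        rw [h2]
        by_cases hω : ∃ x, c < R.var M t ω x
        · rw [Set.indicator_of_mem (by exact hω)]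
          exact prob_le_one.trans le_self_add
        · push Not at hω
          refine (gaussianReal_lt_abs_sub_le _ v hη).trans (le_trans ?_ le_add_self)
          rw [hv rfl]
          exact ENNReal.ofReal_le_ofReal (by gcongr; exact hω x)
    _ = _ := by
        rw [lintegral_add_right _ measurable_const, lintegral_indicator_one hA, lintegral_const,
          measure_univ, mul_one]

/-- By Markov's inequality, the estimate rarely varies more than the sensory function. -/
lemma measure_half_le_posteriorExp_le (h : R.IsMFGP M P) [IsProbabilityMeasure P]
    (hD : IsCompact D) {F : ℝ → ℝ} (hF : ContinuousOn F (Set.Icc 0 1)) (halg : R.IsSMLC M F)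
    (t : ℕ) (η r : ℝ) :
    P {ω | 2⁻¹ ≤ posteriorExp P (R.likFull M t)
      (fun p => (R.oscSet η r).indicator 1 p.1) ω} ≤ 2 * P (R.oscSet η r) := by
  have hB := h.measurableSet_oscSet η r
  have hG : Measurable[R.fieldSigma.prod (R.dataSigma t)]
      fun p : Ω × Ω => (R.oscSet η r).indicator (1 : Ω → ℝ≥0∞) p.1 :=
    measurable_comp_fst (Measurable.indicator measurable_const hB)
  obtain ⟨h1, h2⟩ := h.lintegral_posteriorExp hD hF halg t hG
  have h3 := mul_meas_ge_le_lintegral₀ (μ := P) h1.aemeasurable 2⁻¹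
  rw [← h2, lintegral_indicator_one (h.fieldSigma_le _ hB)] at h3
  rwa [ENNReal.inv_mul_le_iff (by norm_num) (by norm_num)] at h3

end IsMFGP

end SMLCRun

theorem proposition2 {D : Set Plane} (hDcomp : IsCompact D) (hDconv : Convex ℝ D)
    (hDne : D.Nonempty) {s N n₀ : ℕ} (hN : 0 < N)
    {Ω : Type*} [MeasurableSpace Ω] (P : Measure Ω) [IsProbabilityMeasure P]
    (M : MFModel D s) (F : ℝ → ℝ)
    (hFmaps : Set.MapsTo F (Set.Icc 0 1) (Set.Icc 0 1))
    (hFcont : ContinuousOn F (Set.Icc 0 1))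
    (hFmono : StrictMonoOn F (Set.Icc 0 1))
    (R : SMLCRun D s N n₀ Ω) (hmodel : R.IsMFGP M P) (halg : R.IsSMLC M F) :
    ∀ ε : ℝ, 0 < ε →
      Tendsto
        (fun t : ℕ => P {ω | ∃ x : D, ε ≤ |R.est M t ω x - R.φ (Fin.last s) x ω|})
        atTop (𝓝 0) := by
  intro ε hε
  have : CompactSpace D := isCompact_iff_compactSpace.1 hDcomp
  have hη : 0 < ε / 4 := by positivity
  rw [ENNReal.tendsto_nhds_zero]
  intro κ hκ
  have hκ2 : 0 < κ / 2 := ENNReal.half_pos hκ.ne'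
  -- a scale `r` at which the sensory function rarely oscillates
  obtain ⟨r, hr0, hr⟩ : ∃ r : ℝ, 0 < r ∧ 3 * P (R.oscSet (ε / 4) r) ≤ κ / 2 := by
    have h1 := ENNReal.Tendsto.const_mul (a := 3) (hmodel.tendsto_measure_oscSet hDcomp hη)
      (Or.inr (by norm_num))
    rw [mul_zero] at h1
    obtain ⟨n, hn⟩ := (ENNReal.tendsto_nhds_zero.1 h1 _ hκ2).exists
    exact ⟨_, Nat.one_div_pos_of_nat, hn⟩
  obtain ⟨Y, -, hYfin, hY⟩ := (isCompact_univ (X := D)).finite_cover_balls hr0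
  lift Y to Finset D using hYfin
  -- a level `c` of the variance that is negligible at all points of the net
  have hc : Tendsto (fun c : ℝ => Y.card * ENNReal.ofReal (c / (ε / 4) ^ 2)) (𝓝[>] 0) (𝓝 0) := by
    have h1 : Tendsto (fun c : ℝ => c / (ε / 4) ^ 2) (𝓝[>] 0) (𝓝 0) := by
      have : Tendsto (fun c : ℝ => c / (ε / 4) ^ 2) (𝓝 0) (𝓝 (0 / (ε / 4) ^ 2)) :=
        tendsto_id.div_const _
      rw [zero_div] at this
      exact this.mono_left nhdsWithin_le_nhds
    simpa using ENNReal.Tendsto.const_mul (a := Y.card) (ENNReal.tendsto_ofReal h1)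
      (Or.inr (ENNReal.natCast_ne_top _))
  obtain ⟨c, hc, hc0⟩ := ((ENNReal.tendsto_nhds_zero.1 hc _ (ENNReal.half_pos hκ2.ne')).and
    self_mem_nhdsWithin).exists
  have hA : Tendsto (fun t => Y.card * P {ω | ∃ x, c < R.var M t ω x}) atTop (𝓝 0) := by
    simpa using ENNReal.Tendsto.const_mul (a := Y.card)
      (hmodel.tendsto_measure_lt_var hDcomp hN hFmaps hFcont hFmono halg hc0)
      (Or.inr (ENNReal.natCast_ne_top _))
  filter_upwards [ENNReal.tendsto_nhds_zero.1 hA _ (ENNReal.half_pos hκ2.ne')] with t ht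
  let B := R.oscSet (ε / 4) r
  let Q := {ω | 2⁻¹ ≤ posteriorExp P (R.likFull M t) (fun p => B.indicator 1 p.1) ω}
  have hsub : {ω | ∃ x : D, ε ≤ |R.est M t ω x - R.φ (Fin.last s) x ω|} ⊆
      (B ∪ Q) ∪ ⋃ y ∈ Y, {ω | ε / 4 < |R.est M t ω y - R.φ (Fin.last s) y ω|} := by
    rintro ω ⟨x, hx⟩
    by_contra hω
    simp only [Set.mem_union, Set.mem_iUnion, exists_prop, not_or, not_exists, not_and] at hω
    obtain ⟨⟨hB, hQ⟩, hω⟩ := hω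
    obtain ⟨y, hyY, hxy⟩ : ∃ y ∈ Y, dist x y < r := by
      simpa using hY (Set.mem_univ x)
    have h1 : |R.φ (Fin.last s) x ω - R.φ (Fin.last s) y ω| ≤ ε / 4 :=
      not_lt.1 fun hlt => hB ⟨x, y, hxy, hlt⟩
    have h2 : |R.est M t ω x - R.est M t ω y| ≤ ε / 4 :=
      not_lt.1 fun hlt => hQ (hmodel.half_le_posteriorExp_oscSet hxy hlt)
    have h3 : |R.est M t ω y - R.φ (Fin.last s) y ω| ≤ ε / 4 := not_lt.1 (hω y hyY)
    rw [abs_le] at h1 h2 h3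
    have h4 : |R.est M t ω x - R.φ (Fin.last s) x ω| ≤ 3 * (ε / 4) :=
      abs_le.2 ⟨by linarith [h1.2, h2.1, h3.1], by linarith [h1.1, h2.2, h3.2]⟩
    linarith
  calc P {ω | ∃ x : D, ε ≤ |R.est M t ω x - R.φ (Fin.last s) x ω|}
      ≤ (P B + P Q) + ∑ y ∈ Y, P {ω | ε / 4 < |R.est M t ω y - R.φ (Fin.last s) y ω|} :=
        (measure_mono hsub).trans ((measure_union_le _ _).trans
          (add_le_add (measure_union_le _ _) (measure_biUnion_finset_le _ _)))
    _ ≤ (P B + 2 * P B) + ∑ _y ∈ Y, (P {ω | ∃ x, c < R.var M t ω x} +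
          ENNReal.ofReal (c / (ε / 4) ^ 2)) := by
        gcongr with y hy
        · exact hmodel.measure_half_le_posteriorExp_le hDcomp hFcont halg t _ _
        · exact hmodel.measure_lt_abs_est_sub_le hDcomp hFcont halg t hη c y
    _ = 3 * P B + (Y.card * P {ω | ∃ x, c < R.var M t ω x} +
          Y.card * ENNReal.ofReal (c / (ε / 4) ^ 2)) := by
        rw [Finset.sum_const, nsmul_eq_mul, mul_add]; congr 1; ring
    _ ≤ κ / 2 + (κ / 2 / 2 + κ / 2 / 2) := by gcongr
    _ = κ := by rw [ENNReal.add_halves, ENNReal.add_halves]
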